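/- **Lemma 5.2.** Let $H(x)=\tanh(x/\sqrt2)$ be the static kink of the $\phi^4$ equation $\phi_{tt}-\phi_{xx}-\phi+\phi^3=0$, and put $$\mathcal L_H=-\partial_x^2-1+3H^2,\qquad \tilde{\mathcal L}_H=-\partial_x^2+1+H^2,$$ $$Y_1(x)=\operatorname{sech}\big(\tfrac{x}{\sqrt2}\big)\tanh\big(\tfrac{x}{\sqrt2}\big),\qquad Y_0(x)=-\tfrac1{\sqrt3}\operatorname{sech}\big(\tfrac{x}{\sqrt2}\big).$$ Consider the linearized Bäcklund transform, for real-valued $C^2$ functions $\phi,\varphi$ of $(t,x)\in\mathbb R^2$, $$\partial_x\phi-\partial_t\varphi=-\sqrt2\,H\phi,\qquad \partial_t\phi-\partial_x\varphi=-\sqrt2\,H\varphi.\tag{5.5}$$ In spectral statements $\tilde{\mathcal L}_H$ is the operator on $L^2(\mathbb R;\mathbb C)$ with domain $H^2(\mathbb R)$. A *resonance* of a Schrödinger operator at $\lambda$ is a $C^2$ solution $f\in L^\infty\setminus L^2$ of the eigenvalue equation at $\lambda$. Then: 1. If $(\phi,\varphi)$ solves (5.5), then $\phi_{tt}+\mathcal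 L_H\phi=0$ and $\varphi_{tt}+\tilde{\mathcal L}_H\varphi=0$. The converse fails: there are $C^2$ functions $\phi,\varphi$ which satisfy these two equations but not (5.5). Moreover $\tilde{\mathcal L}_H\ge0$, that is, $\langle u,\tilde{\mathcal L}_Hu\rangle$ is real and nonnegative for every $u\in H^2(\mathbb R)$. 2. $(\phi,\varphi)=(H',0)$ solves (5.5). 3. $\sigma(\tilde{\mathcal L}_H)=\{\tfrac32\}\cup[2,\infty)$. The number $0$ is not an eigenvalue of $\tilde{\mathcal L}_H$; $\tfrac32$ is its smallest eigenvalue, with eigenfunction $Y_0$, unique up to scalar multiples; and $H$ is an odd resonance of $\tilde{\mathcal L}_H$ at $\lambda=2$. 4. $(\phi,\varphi)=\big(Y_1(x)\sin(t\sqrt{3/2}),\,Y_0(x)\cos(t\sqrt{3/2})\big)$ solves (5.5). 5. The function $1-\tfrac32\operatorname{sech}^2(x/\sqrt2)$ is an even resonance of $\mathcal L_H$ at $\lambda=2$, and $(\phi,\varphi)=(L_4,M_4)$ solves (5.5), where $$L_4(t,x)=-\Big(1-\tfrac32\operatorname{sech}^2\big(\tfrac{x}{\sqrt2}\big)\Big)\sin(\sqrt2\,t),\qquad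 M_4(t,x)=\tanh\big(\tfrac{x}{\sqrt2}\big)\cos(\sqrt2\,t).$$ -/

import Mathlib

open MeasureTheory TemperedDistribution
open scoped SchwartzMap Laplacian ENNReal

noncomputable section

/-! ### The kink, the profiles and the Schrödinger operators as differential expressions -/

/-- The hyperbolic secant. -/
def sech (x : ℝ) : ℝ := 1 / Real.cosh x

/-- The static `φ⁴` kink `H(x) = tanh (x / √2)`. -/
def kink (x : ℝ) : ℝ := Real.tanh (x / √2)

/-- The potential `-1 + 3 H²` of the operator `L_H = -∂ₓ² - 1 + 3 H²`. -/
def potH (x : ℝ) : ℝ := -1 + 3 * kink x ^ 2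

/-- The potential `1 + H²` of the operator `L̃_H = -∂ₓ² + 1 + H²`. -/
def potTilde (x : ℝ) : ℝ := 1 + kink x ^ 2

/-- The differential expression `-f'' + V f` at `x`. -/
def schrodingerExpr (V f : ℝ → ℝ) (x : ℝ) : ℝ := -deriv (deriv f) x + V x * f x

/-- The internal mode `Y₁` of the kink. -/
def Y₁ (x : ℝ) : ℝ := sech (x / √2) * Real.tanh (x / √2)

/-- The function `Y₀`. -/
def Y₀ (x : ℝ) : ℝ := -(1 / √3) * sech (x / √2)

/-- The spatial profile `1 - (3/2) sech²(x/√2)`. -/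
def resProfile (x : ℝ) : ℝ := 1 - 3 / 2 * sech (x / √2) ^ 2

/-- The function `L₄(t, x)`; the first argument is time. -/
def L₄ (t x : ℝ) : ℝ := -(1 - 3 / 2 * sech (x / √2) ^ 2) * Real.sin (√2 * t)

/-- The function `M₄(t, x)`; the first argument is time. -/
def M₄ (t x : ℝ) : ℝ := Real.tanh (x / √2) * Real.cos (√2 * t)

/-- `(φ, ψ)` (functions of `(t, x)`, time first) is a classical solution, of class `C²`, of the
linearized Bäcklund system around the `φ⁴` kink:
`∂ₓφ - ∂ₜψ = -√2 H φ` and `∂ₜφ - ∂ₓψ = -√2 H ψ`. -/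
structure SolvesLBT (φ ψ : ℝ → ℝ → ℝ) : Prop where
  contDiff_fst : ContDiff ℝ 2 (fun p : ℝ × ℝ => φ p.1 p.2)
  contDiff_snd : ContDiff ℝ 2 (fun p : ℝ × ℝ => ψ p.1 p.2)
  eq_fst : ∀ t x : ℝ,
    deriv (fun y => φ t y) x - deriv (fun s => ψ s x) t = -√2 * kink x * φ t x
  eq_snd : ∀ t x : ℝ,
    deriv (fun s => φ s x) t - deriv (fun y => ψ t y) x = -√2 * kink x * ψ t x

/-- `φ` (a function of `(t, x)`) satisfies `φ_tt + (-∂ₓ² + V) φ = 0` pointwise. -/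
def SolvesWave (V : ℝ → ℝ) (φ : ℝ → ℝ → ℝ) : Prop :=
  ∀ t x : ℝ, deriv (deriv (fun s => φ s x)) t + schrodingerExpr V (φ t) x = 0

/-- `f` is a resonance of `-∂ₓ² + V` at `lam`: a (classical) generalized eigenfunction which lies
in `L^∞ \ L²`. -/
structure IsResonance (V : ℝ → ℝ) (lam : ℝ) (f : ℝ → ℝ) : Prop where
  contDiff : ContDiff ℝ 2 f
  eigen_eq : ∀ x : ℝ, schrodingerExpr V f x = lam * f x
  mem_top : MemLp f ∞ volume
  notMem_two : ¬ MemLp f 2 volume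

/-! ### Spectrum and eigenvalues of unbounded operators -/

section Unbounded

variable {E : Type*} [NormedAddCommGroup E] [NormedSpace ℂ E]

/-- The resolvent set of an unbounded operator `T`: those `z` for which `T - z` is a bijection from
the domain of `T` onto the whole space with a bounded inverse `R`. -/
def unbddResolventSet (T : E →ₗ.[ℂ] E) : Set ℂ :=
  {z | ∃ R : E →L[ℂ] E,
    (∀ f : E, ∃ h : R f ∈ T.domain, T ⟨R f, h⟩ - z • R f = f) ∧
    ∀ u : T.domain, R (T u - z • (u : E)) = (u : E)}

/-- The spectrum of an unbounded operator. -/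
def unbddSpectrum (T : E →ₗ.[ℂ] E) : Set ℂ := (unbddResolventSet T)ᶜ

/-- `u` is an eigenvector of the unbounded operator `T` with eigenvalue `z`. -/
def IsEigenvector (T : E →ₗ.[ℂ] E) (z : ℂ) (u : T.domain) : Prop :=
  u ≠ 0 ∧ T u = z • (u : E)

/-- `z` is an eigenvalue of the unbounded operator `T`. -/
def IsEigenvalue (T : E →ₗ.[ℂ] E) (z : ℂ) : Prop := ∃ u : T.domain, IsEigenvector T z u

end Unbounded

/-! ### Schrödinger operators on `L²(ℝ; ℂ)` with domain `H²(ℝ)` -/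

/-- The complex Hilbert space `L²(ℝ)`. -/
abbrev L2R : Type := Lp ℂ 2 (volume : Measure ℝ)

theorem toTemperedDistribution_inj {v w : L2R} (h : (v : 𝓢'(ℝ, ℂ)) = (w : 𝓢'(ℝ, ℂ))) :
    v = w :=
  LinearMap.ker_eq_bot.mp
    (Lp.ker_toTemperedDistributionCLM_eq_bot (F := ℂ) (p := 2) (μ := (volume : Measure ℝ))) h

theorem toTemperedDistribution_add (v w : L2R) :
    ((v + w : L2R) : 𝓢'(ℝ, ℂ)) = (v : 𝓢'(ℝ, ℂ)) + (w : 𝓢'(ℝ, ℂ)) :=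
  map_add (Lp.toTemperedDistributionCLM ℂ (volume : Measure ℝ) 2) v w

theorem toTemperedDistribution_smul (c : ℂ) (v : L2R) :
    ((c • v : L2R) : 𝓢'(ℝ, ℂ)) = c • (v : 𝓢'(ℝ, ℂ)) :=
  map_smul (Lp.toTemperedDistributionCLM ℂ (volume : Measure ℝ) 2) c v

theorem toTemperedDistribution_zero : ((0 : L2R) : 𝓢'(ℝ, ℂ)) = 0 :=
  map_zero (Lp.toTemperedDistributionCLM ℂ (volume : Measure ℝ) 2)

/-- The Sobolev space `H²(ℝ)` as a subspace of `L²(ℝ)`. -/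
def sobolevH2 : Submodule ℂ L2R where
  carrier := {u | MemSobolev 2 2 (u : 𝓢'(ℝ, ℂ))}
  zero_mem' := by
    simp only [Set.mem_ofPred_eq, toTemperedDistribution_zero]
    exact memSobolev_fun_zero ℝ ℂ 2 2
  add_mem' {u v} hu hv := by
    simp only [Set.mem_ofPred_eq, toTemperedDistribution_add] at *
    exact hu.add hv
  smul_mem' c u hu := by
    simp only [Set.mem_ofPred_eq, toTemperedDistribution_smul] at *
    exact hu.smul c

theorem exists_weakSecondDeriv (u : sobolevH2) :
    ∃ v : L2R, (v : 𝓢'(ℝ, ℂ)) = Δ ((u : L2R) : 𝓢'(ℝ, ℂ)) := by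
  have h : MemSobolev (2 - 2) 2 (Δ ((u : L2R) : 𝓢'(ℝ, ℂ))) := MemSobolev.laplacian u.2
  rw [sub_self, memSobolev_zero_iff] at h
  obtain ⟨v, hv⟩ := h
  exact ⟨v, hv.symm⟩

/-- The weak (distributional) second derivative `H²(ℝ) → L²(ℝ)`, `u ↦ u''`. -/
def weakSecondDeriv : sobolevH2 →ₗ[ℂ] L2R where
  toFun u := Classical.choose (exists_weakSecondDeriv u)
  map_add' u v := by
    apply toTemperedDistribution_inj
    rw [toTemperedDistribution_add, Classical.choose_spec (exists_weakSecondDeriv (u + v)),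
      Classical.choose_spec (exists_weakSecondDeriv u),
      Classical.choose_spec (exists_weakSecondDeriv v)]
    simp only [← laplacianCLM_apply, ← map_add]
    rw [← toTemperedDistribution_add]
    rfl
  map_smul' c u := by
    apply toTemperedDistribution_inj
    rw [RingHom.id_apply, toTemperedDistribution_smul,
      Classical.choose_spec (exists_weakSecondDeriv (c • u)),
      Classical.choose_spec (exists_weakSecondDeriv u)]
    simp only [← laplacianCLM_apply, ← map_smul]
    rw [← toTemperedDistribution_smul]
    rfl

/-- The defining property of the weak second derivative. -/
theorem weakSecondDeriv_spec (u : sobolevH2) :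
    ((weakSecondDeriv u : L2R) : 𝓢'(ℝ, ℂ)) = Δ ((u : L2R) : 𝓢'(ℝ, ℂ)) :=
  Classical.choose_spec (exists_weakSecondDeriv u)

/-- Multiplication by an essentially bounded function `V` on `L²(ℝ)`. -/
def mulPot (V : ℝ → ℝ) (hV : MemLp (fun x => (V x : ℂ)) ∞ volume) : L2R →ₗ[ℂ] L2R where
  toFun u := (hV.toLp (fun x => (V x : ℂ)) : Lp ℂ ∞ (volume : Measure ℝ)) • u
  map_add' u v := Lp.add_smul (p := ∞) (q := 2) (r := 2) (hV.toLp (fun x => (V x : ℂ))) u v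
  map_smul' c u :=
    (Lp.smul_comm (p := ∞) (q := 2) (r := 2) c (hV.toLp (fun x => (V x : ℂ))) u).symm

theorem coeFn_mulPot (V : ℝ → ℝ) (hV : MemLp (fun x => (V x : ℂ)) ∞ volume) (u : L2R) :
    (mulPot V hV u : ℝ → ℂ) =ᵐ[volume] fun x => (V x : ℂ) * u x := by
  have h := Lp.coeFn_lpSMul (p := ∞) (q := 2) (r := 2) (hV.toLp (fun x => (V x : ℂ))) u
  filter_upwards [h, hV.coeFn_toLp] with x hx hx'
  refine Eq.trans hx ?_
  rw [Pi.smul_apply', hx', smul_eq_mul]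

/-- The operator `-∂ₓ² + V` on `L²(ℝ; ℂ)` with domain `H²(ℝ)`. -/
def schrodingerOp (V : ℝ → ℝ) (hV : MemLp (fun x => (V x : ℂ)) ∞ volume) : L2R →ₗ.[ℂ] L2R where
  domain := sobolevH2
  toFun := -weakSecondDeriv + (mulPot V hV).comp sobolevH2.subtype

theorem continuous_kink : Continuous kink := by
  have h : kink = fun x => Real.sinh (x / √2) / Real.cosh (x / √2) := by
    funext x
    exact Real.tanh_eq_sinh_div_cosh _
  rw [h]
  exact (Real.continuous_sinh.comp (by fun_prop)).div (Real.continuous_cosh.comp (by fun_prop))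
    fun x => (Real.cosh_pos _).ne'

theorem memLp_top_potTilde : MemLp (fun x => (potTilde x : ℂ)) ∞ volume := by
  refine memLp_top_of_bound (C := 2) ?_ (Filter.Eventually.of_forall fun x => ?_)
  · have := continuous_kink
    exact Continuous.aestronglyMeasurable (by unfold potTilde; fun_prop)
  · have h : kink x ^ 2 ≤ 1 := by
      rw [sq_le_one_iff_abs_le_one]
      exact (Real.abs_tanh_lt_one _).le
    rw [Complex.norm_real, Real.norm_eq_abs, abs_of_nonneg (by unfold potTilde; positivity)]
    unfold potTilde
    linarith

/-- The operator `L̃_H = -∂ₓ² + 1 + H²` on `L²(ℝ; ℂ)` with domain `H²(ℝ)`. -/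
def opTilde : L2R →ₗ.[ℂ] L2R := schrodingerOp potTilde memLp_top_potTilde

end

/-!
With `a = H / √2` one has `a² + a' = 1/2`, and this gives the Darboux factorization
`L̃_H = -∂² + 1 + 2 a² = (a - ∂) (a + ∂) + 3/2`, whose partner is the free operator
`(a + ∂) (a - ∂) + 3/2 = -∂² + 2`. The spectrum of `L̃_H` is therefore the spectrum `[2, ∞)` of
the partner, together with the eigenvalue `3/2`, whose eigenfunctions are the square integrable
solutions of `u' + a u = 0`, that is, the multiples of `sech (x / √2)`.

The unbounded operators are handled through bounded ones. Let `S = (1 + ∂)⁻¹`, a Fourier multiplier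
on `L²(ℝ; ℂ)`, and `G = S S* = (1 - ∂²)⁻¹`. The domain `H²(ℝ)` is the range of `G`
(`mem_sobolevH2_iff_exists`), and `z` is in the resolvent set of `L̃_H` if and only if the bounded
operator `W(z) = (L̃_H - z) G` is invertible (`mem_resolventSet_opTilde_iff`). Write `C` for the
bounded form `(a - ∂) (1 - ∂)⁻¹` of `a - ∂`, and `E` for the bounded form
`(1 - ∂) (a + ∂) (1 - ∂²)⁻¹` of `a + ∂`. Then the factorization and the intertwining read
`W(z) = C E + (3/2 - z) G`, `C* C = 1 - G / 2` and `C* W(z) = (1 - (z - 1) G) E`, where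
`1 - (z - 1) G = (-∂² + 2 - z) G`. These are consequences of the product rule
`mulL2_mul_firstOrderResolvent` and of `a² + a' = 1/2` by pure algebra (`IsDarbouxTriple`).

* If `z ≠ 3/2` is not in `[2, ∞)`, the inverse of the free operator yields an inverse of `W(z)`
  (`IsDarbouxTriple.isUnit_pencil`).
* If `r ≥ 2` and `W(r)` were invertible, so would be `1 - (r - 1) G`
  (`IsDarbouxTriple.isUnit_of_isUnit_pencil`); but its symbol vanishes at a real frequency
  (`not_isUnit_one_sub_smul`).
* At `z = 3/2`, `exists_ground_state` gives the eigenfunction `Y₀`. Conversely, the intertwining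
  reduces the eigenvalue equation to a weak form of `u' + a u = 0`
  (`IsDarbouxTriple.star_factor_apply_eq_zero`), which `ae_eq_sech_of_star_factor_eq_zero` solves.

An eigenvalue is in the spectrum, so `0` is not one, and `3/2` is the least.
Positivity is `⟨u, L̃_H u⟩ = ‖u'‖² + ‖u‖² + 2 ‖a u‖²` (`IsDarbouxTriple.inner_pencil_zero`). The
remaining statements, on classical solutions of the Bäcklund system and on resonances, are
computations with `H' = (1 - H²) / √2` and `sech² = 1 - H²`.
-/

noncomputable section

/-! ### Factorization of a second order operator, in terms of bounded operators -/

section Algebra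

variable {R : Type*} [Ring R] [StarRing R]

/-- The relations between `S = (1 + ∂)⁻¹`, with adjoint `(1 - ∂)⁻¹`, the multiplication `A` by a
real function `a`, and the multiplication `B` by its derivative `a'`, when `a² + a' = 1/2`. The
unbounded derivative does not occur: `comm_rel` is the product rule `∂ a = a ∂ + a'`, and `add_star`
says `(1 + ∂) + (1 - ∂) = 2`, both multiplied by resolvents from the two sides. The constant `1/2`
is what makes the partner potential `a² + a'` constant. -/
structure IsDarbouxTriple (S A B : R) : Prop where
  comm : star S * S = S * star S
  add_star : S + star S = 2 * (S * star S)
  star_left : star A = A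
  star_right : star B = B
  comm_rel : A * S = S * A + S * B * S
  two_mul_add : 2 * (A * A + B) = 1

/-- The bounded form `(a - ∂) (1 - ∂)⁻¹` of the creation operator `a - ∂`. -/
def darbouxFactor (S A : R) : R := 1 - star S + A * star S

/-- The bounded form `(1 - ∂) (a + ∂) (1 - ∂²)⁻¹` of the annihilation operator `a + ∂`; it is
complementary to `darbouxFactor`, in that the product of the two is `(a - ∂) (a + ∂) (1 - ∂²)⁻¹`. -/
def darbouxCofactor (S A B : R) : R := 1 - S + A * S - B * (star S * S)

namespace IsDarbouxTriple
variable {S A B : R}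

theorem star_rel (h : IsDarbouxTriple S A B) :
    star S * A = A * star S + star S * B * star S := by
  have := congrArg star h.comm_rel
  simpa [h.star_left, h.star_right, mul_assoc] using this

theorem star_darbouxFactor (h : IsDarbouxTriple S A B) :
    star (darbouxFactor S A) = 1 - S + S * A := by
  simp [darbouxFactor, h.star_left]

theorem rel_mixed (h : IsDarbouxTriple S A B) :
    A * star S + S * A = 2 * (S * A * star S) + S * B * star S := by
  have h1 : S * (2 * star S - 1) = star S := by
    have := h.add_star
    rw [mul_sub, mul_one, sub_eq_iff_eq_add, add_comm, this]; noncomm_ring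
  have h2 := congrArg (· * (2 * star S - 1)) h.comm_rel
  simp only [add_mul] at h2
  rw [mul_assoc A, mul_assoc _ S (2 * star S - 1), h1] at h2
  rw [h2]; noncomm_ring

/-- The constant partner: `(∂ + a) (a - ∂) = 1/2 - ∂²`, between `(1 + ∂)⁻¹` and `(1 - ∂)⁻¹`. -/
theorem star_factor_mul_factor (h : IsDarbouxTriple S A B) :
    2 * (star (darbouxFactor S A) * darbouxFactor S A) = 2 - S * star S := by
  rw [h.star_darbouxFactor, darbouxFactor]
  have e : 2 * ((1 - S + S * A) * (1 - star S + A * star S)) =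
    2 - 2 * (S + star S) + 2 * (S * star S) + 2 * (A * star S + S * A) - 4 * (S * A * star S)
      + S * (2 * (A * A + B)) * star S - 2 * (S * B * star S) := by
    rw [← one_add_one_eq_two]; noncomm_ring
  rw [e, h.rel_mixed, h.add_star, h.two_mul_add]
  noncomm_ring

/-- Both sides are `(1 + ∂)⁻¹ (∂ + a) (1 - ∂²)⁻¹`. -/
theorem star_factor_mul (h : IsDarbouxTriple S A B) :
    star (darbouxFactor S A) * (S * star S) = (S * star S) * darbouxCofactor S A B := by
  have h2 := h.comm
  have e4 : S * S * star S = S * star S * S := by rw [mul_assoc, ← h2, ← mul_assoc, ← h2]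
  have e1 : star (darbouxFactor S A) * (S * star S) =
      S * star S - S * star S * S + S * A * (star S * S) := by
    rw [h.star_darbouxFactor, h2, ← e4]; noncomm_ring
  have e2 : S * star S * darbouxCofactor S A B = S * star S - S * star S * S
      + S * (A * star S + star S * B * star S) * S
      - S * star S * B * (star S * S) := by
    rw [darbouxCofactor, ← h.star_rel]; noncomm_ring
  rw [e1, e2]; noncomm_ring

/-- The factorization `(a - ∂) (a + ∂) + 3/2 = -∂² + 1 + 2 a²`, multiplied by `(1 - ∂²)⁻¹` on the
right; the right-hand side spells `-∂² (1 - ∂²)⁻¹` as `1 - (1 - ∂²)⁻¹`. -/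
theorem factor_mul_cofactor (h : IsDarbouxTriple S A B) :
    2 * (darbouxFactor S A * darbouxCofactor S A B) + 3 * (S * star S) =
      2 * (1 - S * star S + (1 + 2 * (A * A)) * (S * star S)) := by
  have e1 : darbouxFactor S A * darbouxCofactor S A B =
      1 - (S + star S) + star S * S + A * (S + star S) - B * (star S * S)
       + (A - 1) * ((star S * A) * S) - A * (star S * S)
       + (1 - A) * (star S * B * (star S * S)) := by
    rw [darbouxFactor, darbouxCofactor]; noncomm_ring
  have e2 : 2 * (B * (S * star S)) = (2 * (A * A + B)) * (S * star S)
      - 2 * (A * A * (S * star S)) := by noncomm_ring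
  rw [h.two_mul_add, h.comm.symm] at e2
  have e3 : 2 * (darbouxFactor S A * darbouxCofactor S A B) + 3 * (S * star S) =
      2 + star S * S - 2 * (B * (star S * S)) + 2 * (A * A * (star S * S)) := by
    rw [e1, h.star_rel, h.add_star, ← h.comm, ← one_add_one_eq_two]; noncomm_ring
  rw [e3, e2, ← h.comm, ← one_add_one_eq_two]
  noncomm_ring

end IsDarbouxTriple
end Algebra

/-! ### Darboux pencils on a Hilbert space -/

section Hilbert

variable {E : Type*} [NormedAddCommGroup E] [InnerProductSpace ℂ E] [CompleteSpace E]

open ContinuousLinearMap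

/-- For `S = (1 + ∂)⁻¹` the operator `S S* = (1 - ∂²)⁻¹` has spectrum in `[0, 1]`, because
`1 - S S* = (1 - S)* (1 - S) ≥ 0`. -/
theorem isUnit_one_sub_smul_of_notMem {S : E →L[ℂ] E} (hc : star S * S = S * star S)
    (ha : S + star S = 2 * (S * star S)) {c : ℂ} (hcc : ∀ r : ℝ, 1 ≤ r → c ≠ r) :
    IsUnit (1 - c • (S * star S)) := by
  by_cases h0 : c = 0
  · simp [h0]
  have hG : 0 ≤ S * star S := mul_star_self_nonneg S
  have hG1 : 0 ≤ 1 - S * star S := by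
    have : 1 - S * star S = star (1 - S) * (1 - S) := by
      simp only [star_sub, star_one]
      have : (1 - star S) * (1 - S) = 1 - (S + star S) + star S * S := by noncomm_ring
      rw [this, ha, hc]; noncomm_ring
    rw [this]; exact star_mul_self_nonneg _
  by_contra hu
  have hmem : c⁻¹ ∈ spectrum ℂ (S * star S) := by
    rw [spectrum.mem_iff]
    intro h
    apply hu
    have : 1 - c • (S * star S) =
        (Units.mk0 c h0) • (algebraMap ℂ (E →L[ℂ] E) c⁻¹ - S * star S) := by
      rw [Units.smul_mk0, smul_sub, Algebra.algebraMap_eq_smul_one, smul_smul,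
        mul_inv_cancel₀ h0, one_smul]
    rw [this]
    exact h.smul _
  have hre := (IsSelfAdjoint.of_nonneg hG).mem_spectrum_eq_re hmem
  set r : ℝ := (c⁻¹).re
  have hmemR : r ∈ spectrum ℝ (S * star S) := by
    rw [hre] at hmem
    exact (spectrum.algebraMap_mem_iff ℂ).1 hmem
  have h1 : 0 ≤ r := spectrum_nonneg_of_nonneg hG hmemR
  have h2 : 0 ≤ 1 - r := by
    apply spectrum_nonneg_of_nonneg hG1
    have := spectrum.singleton_sub_eq (S * star S) (1 : ℝ)
    rw [map_one] at this
    rw [← this]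
    exact Set.sub_mem_sub rfl hmemR
  have hr0 : r ≠ 0 := fun h => by
    rw [h, Complex.ofReal_zero, inv_eq_zero] at hre
    exact h0 hre
  refine hcc r⁻¹ ((one_le_inv₀ (lt_of_le_of_ne h1 hr0.symm)).2 (by linarith)) ?_
  rw [Complex.ofReal_inv, ← hre, inv_inv]

/-- The operator `(T - z) (1 - ∂²)⁻¹` for `T = (a - ∂) (a + ∂) + 3/2`. It is bounded, and it is
invertible exactly if `z` is in the resolvent set of `T`. -/
def darbouxPencil (S A B : E →L[ℂ] E) (z : ℂ) : E →L[ℂ] E :=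
  darbouxFactor S A * darbouxCofactor S A B + (3 / 2 - z : ℂ) • (S * star S)

variable {S A B : E →L[ℂ] E}

theorem IsDarbouxTriple.star_factor_mul_factor_eq (h : IsDarbouxTriple S A B) :
    star (darbouxFactor S A) * darbouxFactor S A = 1 - (1 / 2 : ℂ) • (S * star S) := by
  have h1 : (2 : ℂ) • (star (darbouxFactor S A) * darbouxFactor S A) = 
      (2 : E →L[ℂ] E) - S * star S := by
    rw [two_smul, ← h.star_factor_mul_factor, two_mul]
  have := congrArg ((1 / 2 : ℂ) • ·) h1
  rw [← one_add_one_eq_two (R := E →L[ℂ] E)] at this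
  simp only [smul_smul, smul_sub, smul_add] at this
  norm_num at this
  rw [this]; module

theorem IsDarbouxTriple.pencil_eq (h : IsDarbouxTriple S A B) (z : ℂ) :
    darbouxPencil S A B z =
      1 - ((z + 1) • (1 : E →L[ℂ] E) - (1 + (2 : ℂ) • (A * A))) * (S * star S) := by
  have h1 := congrArg ((1 / 2 : ℂ) • ·) h.factor_mul_cofactor
  have e2 : ∀ X : E →L[ℂ] E, (2 : E →L[ℂ] E) * X = (2 : ℂ) • X := fun X => by rw [two_smul, two_mul]
  have e3 : ∀ X : E →L[ℂ] E, (3 : E →L[ℂ] E) * X = (3 : ℂ) • X := fun X => by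
    rw [show (3 : E →L[ℂ] E) = 1 + 1 + 1 by norm_num, show (3 : ℂ) = 1 + 1 + 1 by norm_num]
    simp only [add_mul, add_smul, one_mul, one_smul]
  simp only [e2, e3, smul_add, smul_smul] at h1
  norm_num at h1
  rw [darbouxPencil, eq_sub_of_add_eq h1]
  simp only [sub_mul, add_mul, smul_mul_assoc, one_mul]
  module

/-- Intertwining with the free operator: `(∂ + a) (T - z) = (-∂² + 2 - z) (∂ + a)`, in
bounded form. -/
theorem IsDarbouxTriple.star_factor_mul_pencil (h : IsDarbouxTriple S A B) (z : ℂ) :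
    star (darbouxFactor S A) * darbouxPencil S A B z
      = (1 - (z - 1) • (S * star S)) * darbouxCofactor S A B := by
  rw [darbouxPencil, mul_add, ← mul_assoc, h.star_factor_mul_factor_eq, mul_smul_comm,
    h.star_factor_mul]
  simp only [sub_mul, smul_mul_assoc, one_mul]
  module

/-- A left inverse of the pencil. From `(a - ∂) (-∂² + 2 - z)⁻¹ (a + ∂)`, which exists by
intertwining, one gets `1 + (z - 3/2) (T - z)⁻¹`, hence the resolvent of `T` since `z ≠ 3/2`. -/
theorem IsDarbouxTriple.exists_mul_pencil_eq_one (h : IsDarbouxTriple S A B) {z : ℂ}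
    (hz : z ≠ 3 / 2) (hz' : ∀ r : ℝ, 1 ≤ r → z - 1 ≠ r) :
    ∃ Y : E →L[ℂ] E, Y * darbouxPencil S A B z = 1 := by
  obtain ⟨N, hN⟩ := isUnit_one_sub_smul_of_notMem h.comm h.add_star hz'
  have hw : z - 3 / 2 ≠ 0 := sub_ne_zero.2 hz
  set C := darbouxFactor S A
  set X : E →L[ℂ] E := (z + 1) • (1 : E →L[ℂ] E) - (1 + (2 : ℂ) • (A * A))
  set Q : E →L[ℂ] E := (z - 3 / 2)⁻¹ • (C * (↑N⁻¹ : E →L[ℂ] E) * star C - 1)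
  have hQ : Q * darbouxPencil S A B z = S * star S := by
    have h1 : C * (↑N⁻¹ : E →L[ℂ] E) * star C * darbouxPencil S A B z =
        C * darbouxCofactor S A B := by
      rw [mul_assoc, h.star_factor_mul_pencil, ← hN, mul_assoc, Units.inv_mul_cancel_left]
    rw [smul_mul_assoc, sub_mul, h1, one_mul, darbouxPencil, sub_add_cancel_left, ← neg_smul,
      neg_sub, smul_smul, inv_mul_cancel₀ hw, one_smul]
  refine ⟨1 + X * Q, ?_⟩
  rw [add_mul, mul_assoc, hQ, h.pencil_eq, one_mul, sub_add_cancel]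

/-- The pencil is `1 - X G` with `G = S S*` and `X*` of the same form at `z̄`. A left inverse at
`z̄` is, after taking adjoints, a right inverse of `1 - G X`, and `1 - X G` is right invertible if
`1 - G X` is. -/
theorem IsDarbouxTriple.isUnit_pencil (h : IsDarbouxTriple S A B) {z : ℂ}
    (hz : z ≠ 3 / 2) (hz' : ∀ r : ℝ, 1 ≤ r → z - 1 ≠ r) :
    IsUnit (darbouxPencil S A B z) := by
  obtain ⟨Y, hY⟩ := h.exists_mul_pencil_eq_one hz hz'
  obtain ⟨Y', hY'⟩ := h.exists_mul_pencil_eq_one (z := star z)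
    (fun e => hz (by rw [← star_star z, e]; simp))
    (fun r hr e => hz' r hr (by
      have := congrArg star e
      simpa using this))
  set X : E →L[ℂ] E := (z + 1) • (1 : E →L[ℂ] E) - (1 + (2 : ℂ) • (A * A)) with hX
  have h1 := congrArg star hY'
  rw [h.pencil_eq, star_mul, star_sub, star_mul, star_mul, star_star, star_one] at h1
  have h2 : star ((star z + 1) • (1 : E →L[ℂ] E) - (1 + (2 : ℂ) • (A * A))) = X := by
    simp [hX, h.star_left]
  rw [h2] at h1
  have h3 : darbouxPencil S A B z * (1 + X * star Y' * (S * star S)) = 1 := by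
    rw [h.pencil_eq, ← hX]
    have : (1 - X * (S * star S)) * (1 + X * star Y' * (S * star S))
      = 1 - X * (S * star S) + X * ((1 - S * star S * X) * star Y') * (S * star S) := by
      noncomm_ring
    rw [this, h1]; noncomm_ring
  exact ⟨⟨_, _, h3, by rw [← left_inv_eq_right_inv hY h3, hY]⟩, rfl⟩

theorem IsDarbouxTriple.isUnit_one_sub_half (h : IsDarbouxTriple S A B) :
    IsUnit (1 - (1 / 2 : ℂ) • (S * star S)) := by
  refine isUnit_one_sub_smul_of_notMem h.comm h.add_star fun r hr e => ?_
  have := congrArg Complex.re e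
  norm_num at this
  linarith

/-- Invertibility passes from `T - r` to the free operator `-∂² + 2 - r`. If `W` and `N` are their
bounded forms and `C`, `E` are the two factors, then `C* W = N E` and `C* C` is invertible, so
`E W⁻¹ C (C* C)⁻¹` is a right inverse of the self-adjoint operator `N`. -/
theorem IsDarbouxTriple.isUnit_of_isUnit_pencil (h : IsDarbouxTriple S A B) {r : ℝ}
    (hr : IsUnit (darbouxPencil S A B r)) : IsUnit (1 - (r - 1 : ℂ) • (S * star S)) := by
  obtain ⟨W, hW⟩ := hr
  obtain ⟨U, hU⟩ := h.isUnit_one_sub_half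
  set N := 1 - (r - 1 : ℂ) • (S * star S) with hN
  have h1 : N * (darbouxCofactor S A B * (↑W⁻¹ : E →L[ℂ] E) * darbouxFactor S A *
      (↑U⁻¹ : E →L[ℂ] E)) = 1 := by
    have h2 := h.star_factor_mul_pencil (r : ℂ)
    rw [← hW, ← hN] at h2
    have h3 := h.star_factor_mul_factor_eq
    rw [← hU] at h3
    rw [← mul_assoc, ← mul_assoc, ← mul_assoc, ← h2, Units.mul_inv_cancel_right, h3,
      Units.mul_inv]
  have hs : star N = N := by simp [hN]
  have h4 := congrArg star h1
  rw [star_mul, hs, star_one] at h4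
  exact ⟨⟨_, _, h1, by rw [← left_inv_eq_right_inv h4 h1, h4]⟩, rfl⟩

/-- At `z = 3/2` the free operator `-∂² + 1/2` is injective, so by intertwining the eigenfunctions
solve the first order equation `(∂ + a) u = 0`. -/
theorem IsDarbouxTriple.star_factor_apply_eq_zero (h : IsDarbouxTriple S A B) {f : E}
    (hf : darbouxPencil S A B (3 / 2) f = 0) : star (darbouxFactor S A) ((S * star S) f) = 0 := by
  obtain ⟨U, hU⟩ := h.isUnit_one_sub_half
  have h1 := h.star_factor_mul_pencil (3 / 2)
  rw [show (3 / 2 - 1 : ℂ) = 1 / 2 by norm_num, ← hU] at h1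
  replace h1 := congrArg (fun Z : E →L[ℂ] E => Z f) h1
  simp only [mul_apply_eq_comp, hf, map_zero] at h1
  have h2 : darbouxCofactor S A B f = 0 := by
    have := congrArg (↑U⁻¹ : E →L[ℂ] E) h1.symm
    rwa [← mul_apply_eq_comp, Units.inv_mul, map_zero] at this
  have h3 := congrArg (fun Z : E →L[ℂ] E => Z f) h.star_factor_mul
  simpa only [mul_apply_eq_comp, h2, map_zero] using h3

/-- The quadratic form of `T = -∂² + 1 + 2 a²` at `u = S S* f`. As `(1 - ∂²) u = f`, the number
`‖S* f‖²` is `‖u‖² + ‖u'‖²`. -/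
theorem IsDarbouxTriple.inner_pencil_zero (h : IsDarbouxTriple S A B) (f : E) :
    inner ℂ ((S * star S) f) (darbouxPencil S A B 0 f) =
      ((‖star S f‖ ^ 2 + 2 * ‖A ((S * star S) f)‖ ^ 2 : ℝ) : ℂ) := by
  have e : darbouxPencil S A B 0 f = f + (2 : ℂ) • A (A ((S * star S) f)) := by
    rw [h.pencil_eq]; simp
  have hA : ∀ x y : E, inner ℂ x (A y) = inner ℂ (A x) y := fun x y => by
    rw [← adjoint_inner_left, ← star_eq_adjoint, h.star_left]
  rw [e, inner_add_right, inner_smul_right, hA, inner_self_eq_norm_sq_to_K,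
    mul_apply_eq_comp,
    ← adjoint_inner_right S, ← star_eq_adjoint, inner_self_eq_norm_sq_to_K]
  simp

/-- If the domain of `T` is the range of an injective bounded operator `G` and `W = T G` is bounded,
then the resolvent set of `T` is that of the pencil `W - z G`. -/
theorem mem_unbddResolventSet_iff {T : E →ₗ.[ℂ] E} {G W : E →L[ℂ] E} (hG : Function.Injective G)
    (hdom : ∀ u, u ∈ T.domain ↔ ∃ f, G f = u)
    (hT : ∀ f (h : G f ∈ T.domain), T ⟨G f, h⟩ = W f) (z : ℂ) :
    z ∈ unbddResolventSet T ↔ IsUnit (W - z • G) := by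
  constructor
  · rintro ⟨Q, h1, h2⟩
    rw [isUnit_iff_bijective]
    constructor
    · rw [injective_iff_map_eq_zero]
      intro f hf
      have hd : G f ∈ T.domain := (hdom _).2 ⟨f, rfl⟩
      have := h2 ⟨G f, hd⟩
      rw [hT] at this
      simp only [sub_apply, smul_apply] at hf
      rw [hf, map_zero] at this
      exact hG (by simpa using this.symm)
    · intro g
      obtain ⟨hd, h3⟩ := h1 g
      obtain ⟨f, hf⟩ := (hdom _).1 hd
      refine ⟨f, ?_⟩
      simp only [← hf] at h3
      rw [hT] at h3
      exact h3
  · rintro ⟨U, hU⟩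
    refine ⟨G * (↑U⁻¹ : E →L[ℂ] E), fun f => ⟨(hdom _).2 ⟨_, rfl⟩, ?_⟩, ?_⟩
    · refine (congrArg (· - _) (hT ((↑U⁻¹ : E →L[ℂ] E) f) ((hdom _).2 ⟨_, rfl⟩))).trans ?_
      have := congrArg (fun Z : E →L[ℂ] E => Z f) U.mul_inv
      rw [hU] at this
      exact this
    · rintro ⟨u, hu⟩
      obtain ⟨f, rfl⟩ := (hdom _).1 hu
      rw [hT]
      have := congrArg (fun Z : E →L[ℂ] E => G (Z f)) U.inv_mul
      rw [hU] at this
      exact this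

end Hilbert

/-! ### Multiplication operators on `L²(ℝ)` -/

section Multiplication
open scoped BoundedContinuousFunction

/-- Multiplication by a bounded continuous function, as an operator on `L²(ℝ)`. -/
def mulL2Aux (m : ℝ →ᵇ ℂ) : L2R →L[ℂ] L2R :=
  (ContinuousLinearMap.mul ℂ ℂ).holderL volume ∞ 2 2 (m.memLp_top.toLp m)

theorem coeFn_mulL2Aux (m : ℝ →ᵇ ℂ) (u : L2R) :
    (mulL2Aux m u : ℝ → ℂ) =ᵐ[volume] fun x => m x * u x := by
  have h := (ContinuousLinearMap.mul ℂ ℂ).coeFn_holder (r := 2) (m.memLp_top.toLp m (μ := volume)) u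
  filter_upwards [h, (m.memLp_top (μ := volume)).coeFn_toLp] with x hx hx'
  refine Eq.trans hx ?_
  rw [hx']
  rfl

theorem inner_mulL2Aux (m : ℝ →ᵇ ℂ) (u v : L2R) :
    inner ℂ u (mulL2Aux m v) = inner ℂ (mulL2Aux (star m) u) v := by
  rw [L2.inner_def, L2.inner_def]
  refine integral_congr_ae ?_
  filter_upwards [coeFn_mulL2Aux m v, coeFn_mulL2Aux (star m) u] with x h1 h2
  rw [h1, h2]
  simp
  ring

/-- The action of the star algebra of bounded continuous functions on `L²(ℝ)` by multiplication. -/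
def mulL2 : (ℝ →ᵇ ℂ) →⋆ₐ[ℂ] (L2R →L[ℂ] L2R) where
  toFun := mulL2Aux
  map_one' := by
    ext1 u
    refine Lp.ext ?_
    filter_upwards [coeFn_mulL2Aux 1 u] with x h
    rw [h]; simp
  map_mul' m n := by
    ext1 u
    refine Lp.ext ?_
    filter_upwards [coeFn_mulL2Aux (m * n) u, coeFn_mulL2Aux m (mulL2Aux n u),
      coeFn_mulL2Aux n u] with x h h1 h2
    rw [h, mul_apply_eq_comp, h1, h2]; simp [mul_assoc]
  map_zero' := by
    ext1 u
    refine Lp.ext ?_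
    filter_upwards [coeFn_mulL2Aux 0 u, Lp.coeFn_zero ℂ 2 (volume : Measure ℝ)] with x h h0
    rw [h]; simp [h0]
  map_add' m n := by
    ext1 u
    refine Lp.ext ?_
    filter_upwards [coeFn_mulL2Aux (m + n) u, coeFn_mulL2Aux m u, coeFn_mulL2Aux n u,
      Lp.coeFn_add (mulL2Aux m u) (mulL2Aux n u)] with x h h1 h2 h3
    refine h.trans (Eq.trans ?_ h3.symm)
    rw [Pi.add_apply, h1, h2]; simp [add_mul]
  commutes' c := by
    ext1 u
    refine Lp.ext ?_
    filter_upwards [coeFn_mulL2Aux (algebraMap ℂ (ℝ →ᵇ ℂ) c) u, Lp.coeFn_smul c u] with x h h1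
    rw [h, ContinuousLinearMap.algebraMap_apply, h1]; simp
  map_star' m := by
    rw [ContinuousLinearMap.star_eq_adjoint]
    refine (ContinuousLinearMap.eq_adjoint_iff _ _).2 fun u v => ?_
    rw [inner_mulL2Aux]

theorem coeFn_mulL2 (m : ℝ →ᵇ ℂ) (u : L2R) :
    (mulL2 m u : ℝ → ℂ) =ᵐ[volume] fun x => m x * u x := coeFn_mulL2Aux m u

/-- If a bounded continuous function vanishes at a point, the multiplication operator is
not bounded below. -/
theorem exists_norm_mulL2_le {m : ℝ →ᵇ ℂ} {k : ℝ} (hk : m k = 0) {δ : ℝ} (hδ : 0 < δ) :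
    ∃ v : L2R, v ≠ 0 ∧ ‖mulL2 m v‖ ≤ δ * ‖v‖ := by
  obtain ⟨ε, hε, hm⟩ := Metric.continuousAt_iff.1 (m.continuous.continuousAt (x := k)) δ hδ
  have hμ : volume (Metric.ball k ε) ≠ ∞ := measure_ball_lt_top.ne
  refine ⟨indicatorConstLp 2 measurableSet_ball hμ (1 : ℂ), fun h0 => ?_, ?_⟩
  · have := norm_indicatorConstLp (p := 2) (s := Metric.ball k ε) (hs := measurableSet_ball)
      (hμs := hμ) (c := (1 : ℂ)) two_ne_zero ENNReal.ofNat_ne_top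
    rw [h0] at this
    simp [Measure.real, Real.volume_ball, hε.le] at this
    exact (Real.rpow_pos_of_pos (by linarith : 0 < 2 * ε) _).ne this
  · refine Lp.norm_le_mul_norm_of_ae_le_mul ?_
    filter_upwards [coeFn_mulL2 m (indicatorConstLp 2 measurableSet_ball hμ (1 : ℂ)),
      indicatorConstLp_coeFn (p := 2) (hs := measurableSet_ball) (hμs := hμ) (c := (1 : ℂ))]
      with x h1 h2
    rw [h1, h2, norm_mul]
    by_cases hx : x ∈ Metric.ball k ε
    · gcongr
      have := hm hx
      rw [hk, dist_zero_right] at this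
      exact this.le
    · simp [hx]

end Multiplication

/-! ### Fourier multipliers and the resolvent of the derivative -/

section Fourier
open scoped BoundedContinuousFunction FourierTransform
open FourierTransform LineDeriv

/-- The Fourier multiplier with a bounded continuous symbol `m`, as an operator on `L²(ℝ)`. The
symbol is a function of the frequency `ξ` in the normalization `e^{2πixξ}`. -/
def fourierMulL2 : (ℝ →ᵇ ℂ) →⋆ₐ[ℂ] (L2R →L[ℂ] L2R) :=
  ((Lp.fourierTransformₗᵢ ℝ ℂ).symm.conjStarAlgEquiv : (L2R →L[ℂ] L2R) →⋆ₐ[ℂ] _).comp mulL2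

theorem fourierMulL2_apply (m : ℝ →ᵇ ℂ) (u : L2R) :
    fourierMulL2 m u = 𝓕⁻ (mulL2 m (𝓕 u)) := rfl

theorem one_add_mul_I_ne_zero (y : ℝ) : (1 + y * Complex.I : ℂ) ≠ 0 := fun h => by
  simpa using congrArg Complex.re h

/-- The symbol `1 / (1 + 2πicξ)` of `(1 + c ∂)⁻¹`. -/
def resolventSymbol (c : ℝ) : ℝ →ᵇ ℂ :=
  .ofNormedAddCommGroup (fun ξ => (1 + (2 * Real.pi * c * ξ : ℝ) * Complex.I)⁻¹)
    (Continuous.inv₀ (by fun_prop) fun ξ => one_add_mul_I_ne_zero _) 1 fun ξ => by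
      rw [norm_inv]
      refine inv_le_one_of_one_le₀ ?_
      refine le_trans ?_ (Complex.abs_re_le_norm _)
      simp

theorem resolventSymbol_apply (c ξ : ℝ) :
    resolventSymbol c ξ = (1 + (2 * Real.pi * c * ξ : ℝ) * Complex.I)⁻¹ := rfl

theorem star_resolventSymbol (c : ℝ) : star (resolventSymbol c) = resolventSymbol (-c) := by
  ext ξ
  rw [BoundedContinuousFunction.star_apply, resolventSymbol_apply, resolventSymbol_apply]
  simp

theorem resolventSymbol_add_star (c : ℝ) :
    resolventSymbol c + star (resolventSymbol c) =
      2 * (resolventSymbol c * star (resolventSymbol c)) := by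
  rw [star_resolventSymbol, two_mul]
  ext ξ
  simp only [BoundedContinuousFunction.add_apply, BoundedContinuousFunction.mul_apply,
    resolventSymbol_apply]
  rw [show 2 * Real.pi * (-c) * ξ = -(2 * Real.pi * c * ξ) by ring]
  generalize 2 * Real.pi * c * ξ = y
  have h1 := one_add_mul_I_ne_zero y
  have h2 := one_add_mul_I_ne_zero (-y)
  rw [← mul_inv, ← two_mul, inv_add_inv h1 h2, div_eq_mul_inv]
  congr 1
  push_cast
  ring

theorem hasTemperateGrowth_resolventSymbol (c : ℝ) :
    (resolventSymbol c : ℝ → ℂ).HasTemperateGrowth := by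
  have h : (resolventSymbol c : ℝ → ℂ) = fun ξ =>
      (1 - Complex.ofReal (2 * Real.pi * c * ξ) * Complex.I) *
        Complex.ofReal ((1 + ‖2 * Real.pi * c * ξ‖ ^ 2) ^ (-1 : ℝ)) := by
    ext ξ
    rw [resolventSymbol_apply, Real.rpow_neg_one]
    have h1 := one_add_mul_I_ne_zero (2 * Real.pi * c * ξ)
    set y := 2 * Real.pi * c * ξ
    have h2 : (1 + y ^ 2 : ℂ) ≠ 0 := by
      norm_cast; positivity
    rw [Real.norm_eq_abs, sq_abs]
    push_cast
    field_simp
    ring_nf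
    simp
  rw [h]
  have hlin : (fun ξ : ℝ => 2 * Real.pi * c * ξ).HasTemperateGrowth := by fun_prop
  have h1 : (fun ξ : ℝ => (1 + ‖2 * Real.pi * c * ξ‖ ^ 2) ^ (-1 : ℝ)).HasTemperateGrowth :=
    (Function.hasTemperateGrowth_one_add_norm_sq_rpow ℝ (-1)).comp hlin
  fun_prop

/-- The operator `(1 + c ∂)⁻¹` on `L²(ℝ)`, for real `c`. It is defined for `c = 0` too, where it is
the identity. -/
def firstOrderResolvent (c : ℝ) : L2R →L[ℂ] L2R := fourierMulL2 (resolventSymbol c)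

theorem star_firstOrderResolvent (c : ℝ) :
    star (firstOrderResolvent c) = firstOrderResolvent (-c) := by
  rw [firstOrderResolvent, ← map_star, star_resolventSymbol, firstOrderResolvent]

theorem firstOrderResolvent_comm (c : ℝ) :
    star (firstOrderResolvent c) * firstOrderResolvent c =
      firstOrderResolvent c * star (firstOrderResolvent c) := by
  rw [firstOrderResolvent, ← map_star, ← map_mul, ← map_mul, mul_comm]

theorem firstOrderResolvent_add_star (c : ℝ) :
    firstOrderResolvent c + star (firstOrderResolvent c) =
      2 * (firstOrderResolvent c * star (firstOrderResolvent c)) := by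
  rw [firstOrderResolvent, ← map_star, ← map_add, resolventSymbol_add_star, map_mul, map_mul,
    map_ofNat]

theorem fourier_deriv (g : 𝓢(ℝ, ℂ)) (ξ : ℝ) :
    𝓕 (SchwartzMap.derivCLM ℂ ℂ g) ξ = 2 * Real.pi * Complex.I * ξ * 𝓕 g ξ := by
  have h : SchwartzMap.derivCLM ℂ ℂ g = ∂_{(1 : ℝ)} g := by
    ext x
    simp [SchwartzMap.lineDerivOp_apply_eq_fderiv]
  rw [h, SchwartzMap.fourier_lineDerivOp_eq]
  rw [SchwartzMap.smul_apply, SchwartzMap.smulLeftCLM_apply_apply (by fun_prop)]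
  simp
  ring

theorem firstOrderResolvent_toLp (c : ℝ) (h : 𝓢(ℝ, ℂ)) :
    firstOrderResolvent c (h.toLp 2) =
      (𝓕⁻ (SchwartzMap.smulLeftCLM ℂ (resolventSymbol c) (𝓕 h))).toLp 2 := by
  rw [firstOrderResolvent, fourierMulL2_apply, SchwartzMap.toLp_fourier_eq,
    ← SchwartzMap.toLp_fourierInv_eq]
  congr 1
  refine Lp.ext ?_
  filter_upwards [coeFn_mulL2 (resolventSymbol c) ((𝓕 h).toLp 2), (𝓕 h).coeFn_toLp 2,
    (SchwartzMap.smulLeftCLM ℂ (resolventSymbol c) (𝓕 h)).coeFn_toLp 2] with ξ h1 h2 h3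
  rw [h1, h2, h3, SchwartzMap.smulLeftCLM_apply_apply (hasTemperateGrowth_resolventSymbol c),
    smul_eq_mul]

theorem firstOrderResolvent_toLp_add (c : ℝ) (g : 𝓢(ℝ, ℂ)) :
    firstOrderResolvent c ((g + (c : ℂ) • SchwartzMap.derivCLM ℂ ℂ g).toLp 2) = g.toLp 2 := by
  rw [firstOrderResolvent_toLp]
  congr 1
  rw [← fourierInv_fourier_eq (E := 𝓢(ℝ, ℂ)) (F := 𝓢(ℝ, ℂ)) g]
  congr 1
  rw [fourierInv_fourier_eq]
  ext ξ
  rw [SchwartzMap.smulLeftCLM_apply_apply (hasTemperateGrowth_resolventSymbol c),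
    FourierTransform.fourier_add, FourierTransform.fourier_smul,
    SchwartzMap.add_apply, SchwartzMap.smul_apply, fourier_deriv,
    resolventSymbol_apply]
  have h1 := one_add_mul_I_ne_zero (2 * Real.pi * c * ξ)
  simp only [smul_eq_mul]
  field_simp
  push_cast
  ring

/-- The operator `1 + c ∂` maps the Schwartz space onto itself, so that identities in `L²` can be
tested on functions of the form `g + c g'`. -/
theorem exists_add_deriv_eq (c : ℝ) (h : 𝓢(ℝ, ℂ)) :
    ∃ g : 𝓢(ℝ, ℂ), g + (c : ℂ) • SchwartzMap.derivCLM ℂ ℂ g = h := by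
  refine ⟨𝓕⁻ (SchwartzMap.smulLeftCLM ℂ (resolventSymbol c) (𝓕 h)), ?_⟩
  rw [← fourierInv_fourier_eq (E := 𝓢(ℝ, ℂ)) (F := 𝓢(ℝ, ℂ)) (_ + _),
    ← fourierInv_fourier_eq (E := 𝓢(ℝ, ℂ)) (F := 𝓢(ℝ, ℂ)) h]
  congr 1
  simp only [fourierInv_fourier_eq]
  ext ξ
  rw [FourierTransform.fourier_add, FourierTransform.fourier_smul,
    SchwartzMap.add_apply, SchwartzMap.smul_apply, fourier_deriv,
    fourier_fourierInv_eq,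
    SchwartzMap.smulLeftCLM_apply_apply (hasTemperateGrowth_resolventSymbol c),
    resolventSymbol_apply]
  have h1 := one_add_mul_I_ne_zero (2 * Real.pi * c * ξ)
  simp only [smul_eq_mul]
  field_simp
  push_cast
  ring

/-- The numbers `1 / r` with `r ≥ 1` are in the spectrum of `(1 - ∂²)⁻¹`: the symbol of
`1 - r (1 - ∂²)⁻¹` vanishes at a real frequency. -/
theorem not_isUnit_one_sub_smul {r : ℝ} (hr : 1 ≤ r) :
    ¬ IsUnit (1 - (r : ℂ) • (firstOrderResolvent 1 * star (firstOrderResolvent 1))) := by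
  set m : ℝ →ᵇ ℂ := 1 - (r : ℂ) • (resolventSymbol 1 * star (resolventSymbol 1)) with hm
  have hop : 1 - (r : ℂ) • (firstOrderResolvent 1 * star (firstOrderResolvent 1)) =
      (Lp.fourierTransformₗᵢ ℝ ℂ).symm.conjStarAlgEquiv (mulL2 m) := by
    change _ = fourierMulL2 m
    rw [hm, firstOrderResolvent, map_sub, map_smul, map_mul, map_star, map_one]
  rw [hop, MulEquiv.isUnit_map]
  rintro ⟨U, hU⟩
  have hk : m (√(r - 1) / (2 * Real.pi)) = 0 := by
    rw [hm, star_resolventSymbol]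
    have h1 := one_add_mul_I_ne_zero (√(r - 1))
    have h2 := one_add_mul_I_ne_zero (-√(r - 1))
    have e1 : 2 * Real.pi * 1 * (√(r - 1) / (2 * Real.pi)) = √(r - 1) := by
      field_simp
    have e2 : 2 * Real.pi * (-1) * (√(r - 1) / (2 * Real.pi)) = -√(r - 1) := by
      field_simp
    have e3 : ((√(r - 1) : ℝ) : ℂ) ^ 2 = r - 1 := by
      rw [← Complex.ofReal_pow, Real.sq_sqrt (by linarith)]; simp
    simp only [BoundedContinuousFunction.sub_apply, BoundedContinuousFunction.smul_apply,
      BoundedContinuousFunction.mul_apply, resolventSymbol_apply, e1, e2, smul_eq_mul]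
    change (1 : ℂ) - _ = 0
    rw [← mul_inv, sub_eq_zero, eq_comm, mul_inv_eq_one₀ (mul_ne_zero h1 h2)]
    push_cast
    linear_combination -e3 + ((√(r - 1) : ℝ) : ℂ) ^ 2 * Complex.I_sq
  set X : L2R →L[ℂ] L2R := ↑U⁻¹
  obtain ⟨v, hv, hle⟩ := exists_norm_mulL2_le hk (δ := (2 * (‖X‖ + 1))⁻¹) (by positivity)
  have h1 : v = X (mulL2 m v) := by
    rw [← hU, ← mul_apply_eq_comp, Units.inv_mul]; rfl
  have h2 : ‖v‖ ≤ ‖X‖ * ((2 * (‖X‖ + 1))⁻¹ * ‖v‖) := by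
    calc ‖v‖ = ‖X (mulL2 m v)‖ := by rw [← h1]
      _ ≤ ‖X‖ * ‖mulL2 m v‖ := X.le_opNorm _
      _ ≤ _ := by gcongr
  have h3 : 0 < ‖v‖ := norm_pos_iff.2 hv
  have h4 : ‖X‖ * (2 * (‖X‖ + 1))⁻¹ < 1 := by
    rw [← div_eq_mul_inv, div_lt_one (by positivity)]
    have := norm_nonneg X
    linarith
  nlinarith

end Fourier

/-! ### Derivatives of functions and the first order resolvent -/

section WeakDeriv
open scoped BoundedContinuousFunction

theorem denseRange_toLp_schwartz :
    DenseRange (SchwartzMap.toLpCLM ℂ (E := ℝ) ℂ 2 volume) :=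
  SchwartzMap.denseRange_toLpCLM ENNReal.ofNat_ne_top

theorem eq_of_inner_toLp_eq {u v : L2R}
    (h : ∀ g : 𝓢(ℝ, ℂ), inner ℂ (g.toLp 2) u = inner ℂ (g.toLp 2) v) : u = v := by
  refine ext_inner_left ℂ fun w => ?_
  refine DenseRange.induction_on (p := fun w : L2R => inner ℂ w u = inner ℂ w v)
    denseRange_toLp_schwartz w ?_ h
  exact isClosed_eq (by fun_prop) (by fun_prop)

theorem eq_of_inner_add_deriv_eq (c : ℝ) {u v : L2R}
    (h : ∀ g : 𝓢(ℝ, ℂ), inner ℂ ((g + (c : ℂ) • SchwartzMap.derivCLM ℂ ℂ g).toLp 2) u =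
      inner ℂ ((g + (c : ℂ) • SchwartzMap.derivCLM ℂ ℂ g).toLp 2) v) : u = v := by
  refine eq_of_inner_toLp_eq fun k => ?_
  obtain ⟨g, rfl⟩ := exists_add_deriv_eq c k
  exact h g

theorem toLp_add_smul (g k : 𝓢(ℝ, ℂ)) (c : ℂ) :
    (g + c • k).toLp 2 volume = g.toLp 2 volume + c • k.toLp 2 volume := by
  have h := map_add (SchwartzMap.toLpCLM ℂ (E := ℝ) ℂ 2 volume) g (c • k)
  rwa [map_smul] at h

theorem inner_toLp_eq_integral (g : 𝓢(ℝ, ℂ)) (u : L2R) :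
    inner ℂ (g.toLp 2) u = ∫ x, star (g x) * u x := by
  rw [L2.inner_def]
  refine integral_congr_ae ?_
  filter_upwards [g.coeFn_toLp 2] with x h
  rw [h, RCLike.inner_apply, mul_comm]; rfl

theorem inner_toLp_deriv {y y' : ℝ → ℂ} (hd : ∀ x, HasDerivAt y (y' x) x) (hy : MemLp y 2)
    (hy' : MemLp y' 2) (g : 𝓢(ℝ, ℂ)) :
    inner ℂ (g.toLp 2) (hy'.toLp y') =
      -inner ℂ ((SchwartzMap.derivCLM ℂ ℂ g).toLp 2) (hy.toLp y) := by
  rw [inner_toLp_eq_integral, inner_toLp_eq_integral]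
  have hg : MemLp (fun x => star (g x)) 2 volume := (g.memLp 2 volume).star
  have hg' : MemLp (fun x => star (deriv g x)) 2 volume :=
    ((SchwartzMap.derivCLM ℂ ℂ g).memLp 2 volume).star
  have h1 := integral_mul_deriv_eq_deriv_mul_of_integrable
    (u := fun x => star (g x)) (u' := fun x => star (deriv g x)) (v := y) (v' := y')
    (fun x _ => (g.hasDerivAt x).star) (fun x _ => hd x)
    (hg.integrable_mul hy') (hg'.integrable_mul hy) (hg.integrable_mul hy)
  refine Eq.trans (integral_congr_ae ?_) (h1.trans (congrArg _ (integral_congr_ae ?_)))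
  · filter_upwards [hy'.coeFn_toLp] with x h
    rw [h]
  · filter_upwards [hy.coeFn_toLp] with x h
    rw [h, SchwartzMap.derivCLM_apply]

/-- The Fourier multiplier `(1 + c ∂)⁻¹` inverts the pointwise operator `y ↦ y + c y'`. -/
theorem firstOrderResolvent_toLp_add_deriv {y y' : ℝ → ℂ} (hd : ∀ x, HasDerivAt y (y' x) x)
    (hy : MemLp y 2 volume) (hy' : MemLp y' 2 volume) (c : ℝ) :
    firstOrderResolvent c (hy.toLp y + (c : ℂ) • hy'.toLp y') = hy.toLp y := by
  refine eq_of_inner_add_deriv_eq (-c) fun g => ?_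
  rw [← ContinuousLinearMap.adjoint_inner_left, ← ContinuousLinearMap.star_eq_adjoint,
    star_firstOrderResolvent, firstOrderResolvent_toLp_add, toLp_add_smul, inner_add_right,
    inner_smul_right, inner_toLp_deriv hd hy hy', inner_add_left, inner_smul_left]
  simp

/-- The product rule `(1 + ∂) α = α (1 + ∂) + α'`, multiplied by `(1 + ∂)⁻¹` on both sides. -/
theorem mulL2_mul_firstOrderResolvent {α β : ℝ →ᵇ ℂ} (hd : ∀ x, HasDerivAt α (β x) x) :
    mulL2 α * firstOrderResolvent 1 =
      firstOrderResolvent 1 * mulL2 α +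
        firstOrderResolvent 1 * mulL2 β * firstOrderResolvent 1 := by
  refine DFunLike.coe_injective (DenseRange.equalizer denseRange_toLp_schwartz
    (by fun_prop) (by fun_prop) ?_)
  ext1 h
  obtain ⟨g, rfl⟩ := exists_add_deriv_eq 1 h
  simp only [Function.comp_apply, add_apply, mul_apply_eq_comp,
    SchwartzMap.toLpCLM_apply, firstOrderResolvent_toLp_add, ← map_add]
  have hm : ∀ (m : ℝ →ᵇ ℂ) (k : 𝓢(ℝ, ℂ)), MemLp (fun x => m x * k x) 2 volume := fun m k =>
    (k.memLp 2 volume).mul (p := ∞) (m.memLp_top (μ := volume))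
  have hd' : ∀ x, HasDerivAt (fun x => α x * g x)
      (β x * g x + α x * SchwartzMap.derivCLM ℂ ℂ g x) x :=
    fun x => (hd x).mul (g.hasDerivAt x)
  have h1 := firstOrderResolvent_toLp_add_deriv hd' (hm α g)
    ((hm β g).add (hm α (SchwartzMap.derivCLM ℂ ℂ g))) 1
  have e1 : ∀ m k, mulL2 m (k.toLp 2 volume) = (hm m k).toLp _ := fun m k => by
    refine Lp.ext ?_
    filter_upwards [(hm m k).coeFn_toLp, coeFn_mulL2 m (k.toLp 2 volume), k.coeFn_toLp 2 volume]
      with x a b c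
    rw [a, b, c]
  rw [e1 α g, ← h1]
  congr 1
  have hadd := toLp_add_smul g (SchwartzMap.derivCLM ℂ ℂ g) ((1 : ℝ) : ℂ)
  rw [hadd, map_add, map_smul, e1 β g, e1 α g, e1 α]
  refine (congrArg (fun w : L2R => (hm α g).toLp _ + ((1 : ℝ) : ℂ) • w)
    (MemLp.toLp_add (hm β g) (hm α (SchwartzMap.derivCLM ℂ ℂ g)))).trans ?_
  simp only [Complex.ofReal_one, one_smul]
  abel

end WeakDeriv

/-! ### The Sobolev space `H²(ℝ)` as the range of `(1 - ∂²)⁻¹` -/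

section Sobolev
open scoped FourierTransform LineDeriv

/-- The complex conjugate of a Schwartz function. It translates the bilinear pairing of tempered
distributions into the sesquilinear inner product of `L²(ℝ)`. -/
def schwartzConj (g : 𝓢(ℝ, ℂ)) : 𝓢(ℝ, ℂ) := g.postcompCLM (Complex.conjCLE : ℂ →L[ℝ] ℂ)

theorem schwartzConj_apply (g : 𝓢(ℝ, ℂ)) (x : ℝ) : schwartzConj g x = star (g x) := rfl

theorem toTemperedDistribution_schwartzConj (u : L2R) (g : 𝓢(ℝ, ℂ)) :
    (u : 𝓢'(ℝ, ℂ)) (schwartzConj g) = inner ℂ (g.toLp 2) u := by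
  rw [Lp.toTemperedDistribution_apply, inner_toLp_eq_integral]
  rfl

theorem laplacian_schwartz_eq (g : 𝓢(ℝ, ℂ)) :
    Δ g = SchwartzMap.derivCLM ℂ ℂ (SchwartzMap.derivCLM ℂ ℂ g) := by
  ext x
  rw [SchwartzMap.laplacian_apply, InnerProductSpace.laplacian_eq_iteratedDeriv_real,
    iteratedDeriv_succ, iteratedDeriv_one, SchwartzMap.derivCLM_apply]
  congr 1

theorem derivCLM_schwartzConj (g : 𝓢(ℝ, ℂ)) :
    SchwartzMap.derivCLM ℂ ℂ (schwartzConj g) = schwartzConj (SchwartzMap.derivCLM ℂ ℂ g) := by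
  ext x
  rw [SchwartzMap.derivCLM_apply, schwartzConj_apply, SchwartzMap.derivCLM_apply]
  exact (g.hasDerivAt x).star.deriv

/-- `v` is the distributional second derivative of `u` in terms of inner products. -/
theorem toTemperedDistribution_eq_laplacian_iff (u v : L2R) :
    (v : 𝓢'(ℝ, ℂ)) = Δ (u : 𝓢'(ℝ, ℂ)) ↔ ∀ g : 𝓢(ℝ, ℂ), inner ℂ (g.toLp 2) v =
      inner ℂ ((SchwartzMap.derivCLM ℂ ℂ (SchwartzMap.derivCLM ℂ ℂ g)).toLp 2) u := by
  have key : ∀ g : 𝓢(ℝ, ℂ), (Δ (u : 𝓢'(ℝ, ℂ))) (schwartzConj g) =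
      inner ℂ ((SchwartzMap.derivCLM ℂ ℂ (SchwartzMap.derivCLM ℂ ℂ g)).toLp 2) u := fun g => by
    rw [TemperedDistribution.laplacian_apply_apply, laplacian_schwartz_eq, derivCLM_schwartzConj,
      derivCLM_schwartzConj, toTemperedDistribution_schwartzConj]
  constructor
  · intro h g
    rw [← toTemperedDistribution_schwartzConj, h, key]
  · intro h
    ext g
    have hg : g = schwartzConj (schwartzConj g) := by
      ext x; simp [schwartzConj_apply]
    rw [hg, key, ← h, toTemperedDistribution_schwartzConj]

/-- Membership in `H²(ℝ)`, which is defined through the Bessel potential of symbol `1 + ξ²`, only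
requires that the second derivative be in `L²`. With the normalization of the Fourier transform the
Bessel potential is `1 - (2π)⁻² ∂²`. -/
theorem mem_sobolevH2_iff (u : L2R) :
    u ∈ sobolevH2 ↔ ∃ v : L2R, (v : 𝓢'(ℝ, ℂ)) = Δ (u : 𝓢'(ℝ, ℂ)) := by
  refine ⟨fun h => exists_weakSecondDeriv ⟨u, h⟩, ?_⟩
  rintro ⟨v, hv⟩
  refine ⟨u - (((2 * Real.pi) ^ 2 : ℝ) : ℂ)⁻¹ • v, ?_⟩
  have h1 : (fun x : ℝ => (((1 + ‖x‖ ^ 2) ^ ((2 : ℝ) / 2) : ℝ) : ℂ)) =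
      (fun _ : ℝ => (1 : ℂ)) + fun x : ℝ => ((‖x‖ ^ 2 : ℝ) : ℂ) := by
    ext x; simp
  have h2 : fourierMultiplierCLM ℂ ((fun _ : ℝ => (1 : ℂ)) + fun x : ℝ => ((‖x‖ ^ 2 : ℝ) : ℂ))
      (u : 𝓢'(ℝ, ℂ)) = (u : 𝓢'(ℝ, ℂ)) +
        fourierMultiplierCLM ℂ (fun x : ℝ => ((‖x‖ ^ 2 : ℝ) : ℂ)) (u : 𝓢'(ℝ, ℂ)) := by
    rw [fourierMultiplierCLM_apply, smulLeftCLM_add (by fun_prop) (by fun_prop)]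
    simp [fourierMultiplierCLM_apply, FourierTransform.fourierInv_add]
  rw [besselPotential, h1, h2]
  have h3 := laplacian_eq_fourierMultiplierCLM (u : 𝓢'(ℝ, ℂ))
  rw [← hv, neg_smul] at h3
  set F := fourierMultiplierCLM ℂ (fun x : ℝ => ((‖x‖ ^ 2 : ℝ) : ℂ)) (u : 𝓢'(ℝ, ℂ))
  have h4 : (v : 𝓢'(ℝ, ℂ)) = -((((2 * Real.pi) ^ 2 : ℝ) : ℂ) • F) := by
    rw [h3]; congr 1
  have h5 : ((u - (((2 * Real.pi) ^ 2 : ℝ) : ℂ)⁻¹ • v : L2R) : 𝓢'(ℝ, ℂ)) =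
      (u : 𝓢'(ℝ, ℂ)) - (((2 * Real.pi) ^ 2 : ℝ) : ℂ)⁻¹ • (v : 𝓢'(ℝ, ℂ)) := by
    rw [← toTemperedDistribution_smul]
    exact map_sub (Lp.toTemperedDistributionCLM ℂ (volume : Measure ℝ) 2) _ _
  have h6 : (((2 * Real.pi) ^ 2 : ℝ) : ℂ) ≠ 0 := by
    rw [Complex.ofReal_ne_zero]; positivity
  rw [h5, h4, smul_neg, sub_neg_eq_add, inv_smul_smul₀ h6]

/-- The operator `(1 - ∂²)⁻¹ = (1 + ∂)⁻¹ (1 - ∂)⁻¹` on `L²(ℝ)`. -/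
def secondOrderResolvent : L2R →L[ℂ] L2R := firstOrderResolvent 1 * star (firstOrderResolvent 1)

theorem secondOrderResolvent_toLp (g : 𝓢(ℝ, ℂ)) :
    secondOrderResolvent ((g - SchwartzMap.derivCLM ℂ ℂ (SchwartzMap.derivCLM ℂ ℂ g)).toLp 2) =
      g.toLp 2 := by
  set D := SchwartzMap.derivCLM ℂ ℂ
  have e : g - D (D g) = (g + D g) + ((-1 : ℝ) : ℂ) • D (g + D g) := by
    simp only [map_add]; push_cast; module
  have e2 : g + D g = g + ((1 : ℝ) : ℂ) • D g := by simp
  rw [secondOrderResolvent, mul_apply_eq_comp, star_firstOrderResolvent, e,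
    firstOrderResolvent_toLp_add, e2, firstOrderResolvent_toLp_add]

theorem star_secondOrderResolvent : star secondOrderResolvent = secondOrderResolvent := by
  simp [secondOrderResolvent]

theorem inner_secondOrderResolvent (g : 𝓢(ℝ, ℂ)) (f : L2R) :
    inner ℂ ((g - SchwartzMap.derivCLM ℂ ℂ (SchwartzMap.derivCLM ℂ ℂ g)).toLp 2)
      (secondOrderResolvent f) = inner ℂ (g.toLp 2) f := by
  rw [← ContinuousLinearMap.adjoint_inner_left, ← ContinuousLinearMap.star_eq_adjoint,
    star_secondOrderResolvent, secondOrderResolvent_toLp]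

theorem toLp_sub (g k : 𝓢(ℝ, ℂ)) : (g - k).toLp 2 volume = g.toLp 2 volume - k.toLp 2 volume := by
  exact map_sub (SchwartzMap.toLpCLM ℂ (E := ℝ) ℂ 2 volume) g k

theorem laplacian_secondOrderResolvent (f : L2R) :
    ((secondOrderResolvent f - f : L2R) : 𝓢'(ℝ, ℂ)) =
      Δ ((secondOrderResolvent f : L2R) : 𝓢'(ℝ, ℂ)) := by
  rw [toTemperedDistribution_eq_laplacian_iff]
  intro g
  rw [inner_sub_right, ← inner_secondOrderResolvent g f, toLp_sub, inner_sub_left]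
  ring

theorem secondOrderResolvent_sub {u v : L2R} (h : (v : 𝓢'(ℝ, ℂ)) = Δ (u : 𝓢'(ℝ, ℂ))) :
    secondOrderResolvent (u - v) = u := by
  rw [toTemperedDistribution_eq_laplacian_iff] at h
  refine eq_of_inner_toLp_eq fun k => ?_
  obtain ⟨g', rfl⟩ := exists_add_deriv_eq (-1) k
  obtain ⟨g, rfl⟩ := exists_add_deriv_eq 1 g'
  set D := SchwartzMap.derivCLM ℂ ℂ
  have e : (g + ((1 : ℝ) : ℂ) • D g) + ((-1 : ℝ) : ℂ) • D (g + ((1 : ℝ) : ℂ) • D g)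
      = g - D (D g) := by
    simp only [map_add, map_smul]; push_cast; module
  rw [e, inner_secondOrderResolvent, toLp_sub, inner_sub_left, inner_sub_right, h]

theorem secondOrderResolvent_mem (f : L2R) : secondOrderResolvent f ∈ sobolevH2 :=
  (mem_sobolevH2_iff _).2 ⟨_, laplacian_secondOrderResolvent f⟩

theorem mem_sobolevH2_iff_exists (u : L2R) :
    u ∈ sobolevH2 ↔ ∃ f, secondOrderResolvent f = u := by
  constructor
  · intro h
    obtain ⟨v, hv⟩ := (mem_sobolevH2_iff u).1 h
    exact ⟨_, secondOrderResolvent_sub hv⟩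
  · rintro ⟨f, rfl⟩
    exact secondOrderResolvent_mem f

theorem weakSecondDeriv_secondOrderResolvent (f : L2R) (h : secondOrderResolvent f ∈ sobolevH2) :
    weakSecondDeriv ⟨secondOrderResolvent f, h⟩ = secondOrderResolvent f - f :=
  toTemperedDistribution_inj
    ((weakSecondDeriv_spec _).trans (laplacian_secondOrderResolvent f).symm)

theorem secondOrderResolvent_injective : Function.Injective secondOrderResolvent := by
  rw [injective_iff_map_eq_zero]
  intro f hf
  refine eq_of_inner_toLp_eq fun g => ?_
  rw [← inner_secondOrderResolvent, hf, inner_zero_right, inner_zero_right]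

end Sobolev

/-! ### The kink and its superpotential -/

section Kink
open scoped BoundedContinuousFunction

theorem hasDerivAt_kink (x : ℝ) : HasDerivAt kink ((1 - kink x ^ 2) / √2) x := by
  have hc := (Real.cosh_pos (x / √2)).ne'
  have h2 : HasDerivAt (fun y : ℝ => y / √2) (1 / √2) x := (hasDerivAt_id x).div_const _
  have h : HasDerivAt (fun y => Real.sinh (y / √2) / Real.cosh (y / √2)) _ x :=
    ((Real.hasDerivAt_sinh _).comp x h2).div ((Real.hasDerivAt_cosh _).comp x h2) hc
  have e : kink = fun y => Real.sinh (y / √2) / Real.cosh (y / √2) := by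
    funext y; exact Real.tanh_eq_sinh_div_cosh _
  rw [e]
  convert! h using 1
  simp only [Function.comp_apply]
  field_simp

theorem sech_pos (x : ℝ) : 0 < sech x := one_div_pos.2 (Real.cosh_pos x)

theorem sech_sq (x : ℝ) : sech (x / √2) ^ 2 = 1 - kink x ^ 2 := by
  have hc := (Real.cosh_pos (x / √2)).ne'
  rw [sech, kink, Real.tanh_eq_sinh_div_cosh]
  field_simp
  linarith [Real.cosh_sq (x / √2)]

theorem hasDerivAt_sech (x : ℝ) :
    HasDerivAt (fun y => sech (y / √2)) (-(kink x / √2) * sech (x / √2)) x := by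
  have hc := (Real.cosh_pos (x / √2)).ne'
  have h2 : HasDerivAt (fun y : ℝ => y / √2) (1 / √2) x := (hasDerivAt_id x).div_const _
  have h : HasDerivAt (fun y => 1 / Real.cosh (y / √2)) _ x :=
    (hasDerivAt_const x (1 : ℝ)).div ((Real.hasDerivAt_cosh _).comp x h2) hc
  convert! h using 1
  simp only [Function.comp_apply, sech, kink, Real.tanh_eq_sinh_div_cosh]
  field_simp
  simp

theorem abs_kink_le (x : ℝ) : |kink x| ≤ 1 := (Real.abs_tanh_lt_one _).le

theorem sqrt_two_sq : √(2 : ℝ) * √2 = 2 := Real.mul_self_sqrt zero_le_two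

theorem continuous_sech : Continuous fun x : ℝ => sech (x / √2) :=
  continuous_iff_continuousAt.2 fun x => (hasDerivAt_sech x).continuousAt

/-- The function `a = H / √2`, for which `-∂² + 1 + H² = (a - ∂) (a + ∂) + 3/2`. -/
def superpotential : ℝ →ᵇ ℂ :=
  .ofNormedAddCommGroup (fun x => ((kink x / √2 : ℝ) : ℂ))
    (Complex.continuous_ofReal.comp (continuous_kink.div_const _)) 1 fun x => by
      rw [Complex.norm_real, Real.norm_eq_abs, abs_div, abs_of_nonneg (Real.sqrt_nonneg 2)]
      refine div_le_one_of_le₀ ((abs_kink_le x).trans ?_) (Real.sqrt_nonneg 2)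
      exact Real.one_le_sqrt.2 one_le_two

/-- The derivative `(1 - H²) / 2` of the superpotential. -/
def superpotentialDeriv : ℝ →ᵇ ℂ :=
  .ofNormedAddCommGroup (fun x => (((1 - kink x ^ 2) / 2 : ℝ) : ℂ))
    (Complex.continuous_ofReal.comp
      ((continuous_const.sub (continuous_kink.pow 2)).div_const _)) 1 fun x => by
      have h1 := (sq_le_one_iff_abs_le_one _).2 (abs_kink_le x)
      rw [Complex.norm_real, Real.norm_eq_abs, abs_le]
      constructor <;> nlinarith [sq_nonneg (kink x)]

theorem superpotential_apply (x : ℝ) : superpotential x = ((kink x / √2 : ℝ) : ℂ) := rfl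

theorem superpotentialDeriv_apply (x : ℝ) :
    superpotentialDeriv x = (((1 - kink x ^ 2) / 2 : ℝ) : ℂ) := rfl

theorem hasDerivAt_superpotential (x : ℝ) :
    HasDerivAt superpotential (superpotentialDeriv x) x := by
  have h := ((hasDerivAt_kink x).div_const √2).ofReal_comp
  convert! h using 1
  rw [superpotentialDeriv_apply, div_div, sqrt_two_sq]

theorem two_mul_superpotential (x : ℝ) :
    2 * (superpotential x * superpotential x) = ((kink x ^ 2 : ℝ) : ℂ) := by
  rw [superpotential_apply]
  have : (2 : ℂ) = ((√2 * √2 : ℝ) : ℂ) := by rw [sqrt_two_sq]; simp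
  rw [this]
  norm_cast
  have : √(2 : ℝ) ≠ 0 := by positivity
  field_simp

theorem isDarbouxTriple_kink :
    IsDarbouxTriple (firstOrderResolvent 1) (mulL2 superpotential) (mulL2 superpotentialDeriv) where
  comm := firstOrderResolvent_comm 1
  add_star := firstOrderResolvent_add_star 1
  star_left := by
    rw [← map_star]; congr 1; ext x
    rw [BoundedContinuousFunction.star_apply, superpotential_apply]; exact Complex.conj_ofReal _
  star_right := by
    rw [← map_star]; congr 1; ext x
    rw [BoundedContinuousFunction.star_apply, superpotentialDeriv_apply]
    exact Complex.conj_ofReal _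
  comm_rel := mulL2_mul_firstOrderResolvent hasDerivAt_superpotential
  two_mul_add := by
    rw [← map_mul, ← map_add, two_mul, ← map_add, ← map_one mulL2]
    congr 1
    ext x
    have h := two_mul_superpotential x
    change _ + superpotentialDeriv x + (_ + superpotentialDeriv x) = 1
    rw [superpotentialDeriv_apply, BoundedContinuousFunction.mul_apply]
    push_cast at h ⊢
    linear_combination h

end Kink

/-! ### The operator `L̃_H` and its pencil -/

section Operator

/-- The operator pencil `(L̃_H - z) (1 - ∂²)⁻¹`. -/
def kinkPencil (z : ℂ) : L2R →L[ℂ] L2R :=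
  darbouxPencil (firstOrderResolvent 1) (mulL2 superpotential) (mulL2 superpotentialDeriv) z

theorem kinkPencil_apply (z : ℂ) (f : L2R) :
    kinkPencil z f = f + (2 : ℂ) • mulL2 superpotential (mulL2 superpotential
      (secondOrderResolvent f)) - z • secondOrderResolvent f := by
  rw [kinkPencil, isDarbouxTriple_kink.pencil_eq, ← secondOrderResolvent]
  simp only [sub_apply, one_apply_eq_self,
    mul_apply_eq_comp, smul_apply, add_apply]
  module

theorem mulPot_potTilde (u : L2R) :
    mulPot potTilde memLp_top_potTilde u =
      u + (2 : ℂ) • mulL2 superpotential (mulL2 superpotential u) := by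
  refine Lp.ext ?_
  filter_upwards [coeFn_mulPot potTilde memLp_top_potTilde u,
    Lp.coeFn_add u ((2 : ℂ) • mulL2 superpotential (mulL2 superpotential u)),
    Lp.coeFn_smul (2 : ℂ) (mulL2 superpotential (mulL2 superpotential u)),
    coeFn_mulL2 superpotential (mulL2 superpotential u),
    coeFn_mulL2 superpotential u] with x h1 h2 h3 h4 h5
  rw [h1, h2, Pi.add_apply, h3, Pi.smul_apply, h4, h5, potTilde, smul_eq_mul]
  have h := two_mul_superpotential x
  push_cast at h ⊢
  linear_combination -(u x) * h

theorem opTilde_secondOrderResolvent (f : L2R) (h : secondOrderResolvent f ∈ opTilde.domain) :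
    opTilde ⟨secondOrderResolvent f, h⟩ = kinkPencil 0 f := by
  change secondOrderResolvent f ∈ sobolevH2 at h
  have e : opTilde ⟨secondOrderResolvent f, h⟩ =
      -weakSecondDeriv ⟨secondOrderResolvent f, h⟩ +
        mulPot potTilde memLp_top_potTilde (secondOrderResolvent f) := rfl
  rw [e, weakSecondDeriv_secondOrderResolvent f h, mulPot_potTilde, kinkPencil_apply]
  module

theorem mem_resolventSet_opTilde_iff (z : ℂ) :
    z ∈ unbddResolventSet opTilde ↔ IsUnit (kinkPencil z) := by
  rw [mem_unbddResolventSet_iff secondOrderResolvent_injective mem_sobolevH2_iff_exists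
    opTilde_secondOrderResolvent]
  have : kinkPencil 0 - z • secondOrderResolvent = kinkPencil z := by
    ext1 f
    rw [sub_apply, smul_apply, kinkPencil_apply,
      kinkPencil_apply]
    module
  rw [this]

theorem inner_opTilde (u : opTilde.domain) :
    ∃ r : ℝ, 0 ≤ r ∧ inner ℂ (u : L2R) (opTilde u) = (r : ℂ) := by
  obtain ⟨u, hu⟩ := u
  obtain ⟨f, rfl⟩ := (mem_sobolevH2_iff_exists u).1 hu
  rw [opTilde_secondOrderResolvent]
  refine ⟨_, ?_, isDarbouxTriple_kink.inner_pencil_zero f⟩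
  positivity

end Operator

/-! ### The eigenspace at `3/2` -/

section GroundState
open scoped BoundedContinuousFunction

theorem one_add_sq_le_cosh_sq (t : ℝ) : 1 + t ^ 2 ≤ Real.cosh t ^ 2 := by
  rw [Real.cosh_sq, add_comm]
  have : t ^ 2 ≤ Real.sinh t ^ 2 := by
    rw [sq_le_sq, Real.abs_sinh]
    exact Real.self_le_sinh_iff.2 (abs_nonneg t)
  linarith

theorem memLp_sech : MemLp (fun x : ℝ => ((sech (x / √2) : ℝ) : ℂ)) 2 volume := by
  suffices h : MemLp (fun x : ℝ => sech (x / √2)) 2 volume from h.ofReal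
  rw [memLp_two_iff_integrable_sq continuous_sech.aestronglyMeasurable]
  refine ((integrable_inv_one_add_sq).const_mul 2).mono'
    (continuous_sech.pow 2).aestronglyMeasurable (.of_forall fun x => ?_)
  rw [Real.norm_eq_abs, abs_of_nonneg (sq_nonneg _), sech, div_pow, one_pow, ← div_eq_mul_inv,
    div_le_div_iff₀ (by positivity) (by positivity)]
  have := one_add_sq_le_cosh_sq (x / √2)
  rw [div_pow, Real.sq_sqrt zero_le_two] at this
  nlinarith

/-- A classical `H²` function `y` is the image of `y - y''` under `(1 - ∂²)⁻¹`. -/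
theorem secondOrderResolvent_toLp_sub {y y' y'' : ℝ → ℂ} (hd : ∀ x, HasDerivAt y (y' x) x)
    (hd' : ∀ x, HasDerivAt y' (y'' x) x)
    (hy : MemLp y 2 volume) (hy' : MemLp y' 2 volume) (hy'' : MemLp y'' 2 volume) :
    secondOrderResolvent (hy.toLp y - hy''.toLp y'') = hy.toLp y := by
  have h1 := firstOrderResolvent_toLp_add_deriv (fun x => (hd x).add (hd' x))
    (hy.add hy') (hy'.add hy'') (-1)
  have h2 := firstOrderResolvent_toLp_add_deriv hd hy hy' 1
  rw [secondOrderResolvent, mul_apply_eq_comp, star_firstOrderResolvent]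
  have e : hy.toLp y - hy''.toLp y'' =
      (hy.add hy').toLp (y + y') + ((-1 : ℝ) : ℂ) • (hy'.add hy'').toLp (y' + y'') := by
    rw [MemLp.toLp_add hy hy', MemLp.toLp_add hy' hy'']
    push_cast
    module
  rw [e]
  refine (congrArg _ h1).trans (Eq.trans ?_ h2)
  congr 1
  refine (MemLp.toLp_add hy hy').trans ?_
  simp

/-- The multiples of `sech (x / √2)` are eigenfunctions at `3/2`. They are obtained from
`a y + y' = 0`, which gives `y'' = (2 a² - 1/2) y`. -/
theorem exists_ground_state (k : ℝ) : ∃ f : L2R,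
    (secondOrderResolvent f : ℝ → ℂ) =ᵐ[volume] (fun x => ((k * sech (x / √2) : ℝ) : ℂ)) ∧
      kinkPencil (3 / 2) f = 0 := by
  set y : ℝ → ℂ := fun x => ((k * sech (x / √2) : ℝ) : ℂ) with hy_def
  set q : ℝ →ᵇ ℂ := 2 * superpotential * superpotential - (1 / 2 : ℂ) • 1 with hq_def
  have hq : ∀ x, q x = ((kink x ^ 2 - 1 / 2 : ℝ) : ℂ) := fun x => by
    have h := two_mul_superpotential x
    rw [← mul_assoc] at h
    change 2 * superpotential x * superpotential x - (1 / 2 : ℂ) * 1 = _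
    rw [h]
    push_cast
    ring
  have hr : ∀ x, HasDerivAt (fun x => k * sech (x / √2)) (-(kink x / √2) * (k * sech (x / √2))) x :=
    fun x => by
      convert! (hasDerivAt_sech x).const_mul k using 1
      ring
  have hd : ∀ x, HasDerivAt y ((-superpotential) x * y x) x := fun x => by
    convert! (hr x).ofReal_comp using 1
    change -superpotential x * y x = _
    rw [superpotential_apply, hy_def]
    push_cast
    ring
  have hd' : ∀ x, HasDerivAt (fun x => (-superpotential) x * y x)
      (q x * y x) x := fun x => by
    have h1 := (hasDerivAt_superpotential x).neg.mul (hd x)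
    convert! h1 using 1
    change q x * y x = -superpotentialDeriv x * y x +
      (-superpotential x) * ((-superpotential x) * y x)
    have h := two_mul_superpotential x
    rw [hq, superpotentialDeriv_apply]
    push_cast at h ⊢
    linear_combination -(y x / 2) * h
  have hy : MemLp y 2 volume := by
    convert! memLp_sech.const_mul (k : ℂ) using 1
    ext x
    simp [hy_def]
  have hm : ∀ m : ℝ →ᵇ ℂ, MemLp (fun x => m x * y x) 2 volume := fun m =>
    hy.mul (p := ∞) (m.memLp_top (μ := volume))
  have hG := secondOrderResolvent_toLp_sub hd hd' hy (hm _) (hm q)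
  refine ⟨hy.toLp y - (hm q).toLp _, ?_, ?_⟩
  rotate_left
  · rw [kinkPencil_apply, hG]
    have hmul : (hm q).toLp _ = mulL2 q (hy.toLp y) := by
      refine Lp.ext ?_
      filter_upwards [(hm q).coeFn_toLp, coeFn_mulL2 q (hy.toLp y), hy.coeFn_toLp] with x a b c
      rw [a, b, c]
    have hop : mulL2 q (hy.toLp y) = (2 : ℂ) • mulL2 superpotential (mulL2 superpotential
        (hy.toLp y)) - (1 / 2 : ℂ) • hy.toLp y := by
      have : q = (2 : ℂ) • (superpotential * superpotential) - (1 / 2 : ℂ) • 1 := by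
        rw [hq_def, mul_assoc, two_mul, two_smul]
      rw [this, map_sub, map_smul, map_smul, map_mul, map_one]
      rfl
    rw [hmul, hop]
    module
  · rw [hG]
    exact hy.coeFn_toLp

/-- If `(1 + ∂)⁻¹ (∂ + a) u = 0`, then `u` is orthogonal to `a y - y'` for all classical `y` with
`y, y' ∈ L²`. This is the weak form of `u' + a u = 0`. -/
theorem inner_star_deriv_eq_zero {u : L2R}
    (hu : star (darbouxFactor (firstOrderResolvent 1) (mulL2 superpotential)) u = 0)
    {y y' : ℝ → ℂ} (hd : ∀ x, HasDerivAt y (y' x) x) (hy : MemLp y 2 volume)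
    (hy' : MemLp y' 2 volume) :
    inner ℂ (-hy'.toLp y' + mulL2 superpotential (hy.toLp y)) u = 0 := by
  have h1 := firstOrderResolvent_toLp_add_deriv hd hy hy' (-1)
  rw [← star_firstOrderResolvent] at h1
  have h2 : darbouxFactor (firstOrderResolvent 1) (mulL2 superpotential)
      (hy.toLp y + ((-1 : ℝ) : ℂ) • hy'.toLp y') =
        -hy'.toLp y' + mulL2 superpotential (hy.toLp y) := by
    simp only [darbouxFactor, add_apply, sub_apply,
      one_apply_eq_self, mul_apply_eq_comp, h1]
    push_cast
    module
  rw [← h2, ← ContinuousLinearMap.adjoint_inner_right, ← ContinuousLinearMap.star_eq_adjoint, hu,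
    inner_zero_right]

/-- A continuous compactly supported function orthogonal to `sech (x / √2)` is of the form
`a ψ - ψ'` with `ψ` compactly supported, by variation of constants: `ψ = -(∫ sech φ) / sech`. -/
theorem exists_compact_primitive {φ : ℝ → ℝ} (hc : Continuous φ) (hs : HasCompactSupport φ)
    (h0 : ∫ x, sech (x / √2) * φ x = 0) :
    ∃ ψ : ℝ → ℝ, HasCompactSupport ψ ∧
      ∀ x, HasDerivAt ψ (kink x / √2 * ψ x - φ x) x := by
  obtain ⟨M, hM⟩ := hs.isBounded.subset_closedBall 0
  have hcont : Continuous fun x => sech (x / √2) * φ x := continuous_sech.mul hc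
  have hsupp : ∀ x, φ x ≠ 0 → -(M + 1) < x ∧ x ≤ M + 1 := fun x hx => by
    have := hM (subset_tsupport φ hx)
    rw [Metric.mem_closedBall, Real.dist_eq, sub_zero, abs_le] at this
    constructor <;> linarith
  set F : ℝ → ℝ := fun x => ∫ t in (-(M + 1))..x, sech (t / √2) * φ t with hF
  have hFd : ∀ x, HasDerivAt F (sech (x / √2) * φ x) x := fun x =>
    intervalIntegral.integral_hasDerivAt_right (hcont.intervalIntegrable _ _)
      hcont.aestronglyMeasurable.stronglyMeasurableAtFilter hcont.continuousAt
  have hF0 : ∀ x, x ∉ Set.Icc (-(M + 1)) (M + 1) → F x = 0 := fun x hx => by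
    rw [Set.mem_Icc, not_and_or, not_le, not_le] at hx
    rcases hx with hx | hx
    · refine (intervalIntegral.integral_congr (g := fun _ => 0) fun t ht => ?_).trans (by simp)
      rw [Set.uIcc_of_ge hx.le] at ht
      have : φ t = 0 := by
        by_contra h
        linarith [(hsupp t h).1, ht.2]
      simp [this]
    · rw [hF]
      refine (intervalIntegral.integral_eq_integral_of_support_subset fun t ht => ?_).trans h0
      have := hsupp t fun h => ht (by simp [h])
      exact ⟨this.1, by linarith⟩
  refine ⟨fun x => -(F x / sech (x / √2)), ?_, fun x => ?_⟩
  · refine HasCompactSupport.intro isCompact_Icc (K := Set.Icc (-(M + 1)) (M + 1)) fun x hx => ?_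
    simp [hF0 x hx]
  · have hp := (sech_pos (x / √2)).ne'
    convert! ((hFd x).div (hasDerivAt_sech x) hp).neg using 1
    field_simp
    ring

/-- The weak solutions `u ∈ L²` of `u' + a u = 0` are the multiples of `sech (x / √2)`. A test
function `φ` orthogonal to `sech` is orthogonal to `u`, by `exists_compact_primitive`; a general one
is made orthogonal to `sech` by subtracting a multiple of a fixed bump function `χ`. -/
theorem ae_eq_sech_of_star_factor_eq_zero {u : L2R}
    (hu : star (darbouxFactor (firstOrderResolvent 1) (mulL2 superpotential)) u = 0) :
    ∃ c : ℂ, (u : ℝ → ℂ) =ᵐ[volume] fun x => c * (sech (x / √2) : ℂ) := by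
  have key : ∀ φ : ℝ → ℝ, Continuous φ → HasCompactSupport φ →
      ∫ x, sech (x / √2) * φ x = 0 → ∫ x, (φ x : ℂ) * u x = 0 := by
    intro φ hc hs h0
    obtain ⟨ψ, hψs, hψ⟩ := exists_compact_primitive hc hs h0
    have hψc : Continuous ψ := continuous_iff_continuousAt.2 fun x => (hψ x).continuousAt
    have hy : MemLp (fun x => (ψ x : ℂ)) 2 volume :=
      (hψc.memLp_of_hasCompactSupport hψs).ofReal
    have hy' : MemLp (fun x => ((kink x / √2 * ψ x - φ x : ℝ) : ℂ)) 2 volume := by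
      refine (Continuous.memLp_of_hasCompactSupport ?_ ?_).ofReal
      · exact ((continuous_kink.div_const _).mul hψc).sub hc
      · exact (hψs.mul_left).sub hs
    have h := inner_star_deriv_eq_zero hu (fun x => (hψ x).ofReal_comp) hy hy'
    rw [L2.inner_def] at h
    rw [← h]
    refine integral_congr_ae ?_
    filter_upwards [Lp.coeFn_add (-hy'.toLp _) (mulL2 superpotential (hy.toLp _)),
      Lp.coeFn_neg (hy'.toLp _), hy'.coeFn_toLp, coeFn_mulL2 superpotential (hy.toLp _),
      hy.coeFn_toLp] with x h1 h2 h3 h4 h5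
    rw [h1, Pi.add_apply, h2, Pi.neg_apply, h3, h4, h5, superpotential_apply, RCLike.inner_apply,
      mul_comm]
    congr 1
    rw [← Complex.ofReal_mul, ← Complex.ofReal_neg, ← Complex.ofReal_add]
    refine Eq.trans ?_ (Complex.conj_ofReal _).symm
    congr 1
    ring
  have hsc := continuous_sech
  -- a fixed test function with nonzero integral against `sech`
  let χ : ContDiffBump (0 : ℝ) := ⟨1, 2, one_pos, one_lt_two⟩
  have hint : ∀ φ : ℝ → ℝ, Continuous φ → HasCompactSupport φ →
      Integrable fun x => sech (x / √2) * φ x := fun φ hc hs =>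
    (hsc.mul hc).integrable_of_hasCompactSupport hs.mul_left
  have hintu : ∀ φ : ℝ → ℝ, Continuous φ → HasCompactSupport φ →
      Integrable fun x => (φ x : ℂ) * u x := fun φ hc hs =>
    MemLp.integrable_mul (p := 2) (q := 2) ((hc.memLp_of_hasCompactSupport hs).ofReal) (Lp.memLp u)
  set J := ∫ x, sech (x / √2) * χ x with hJ
  have hJpos : 0 < J := by
    refine (hsc.mul χ.continuous).integral_pos_of_hasCompactSupport_nonneg_nonzero
      χ.hasCompactSupport.mul_left (fun x => mul_nonneg (sech_pos _).le χ.nonneg) (x := 0) ?_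
    exact mul_ne_zero (sech_pos _).ne' (χ.pos_of_mem_ball (by simp [χ])).ne'
  refine ⟨(∫ x, (χ x : ℂ) * u x) / J, ?_⟩
  set c := (∫ x, (χ x : ℂ) * u x) / J with hcdef
  have hloc : LocallyIntegrable (fun x => u x - c * (sech (x / √2) : ℂ)) volume := by
    refine LocallyIntegrable.sub ((Lp.memLp u).locallyIntegrable one_le_two) ?_
    exact (continuous_const.mul (Complex.continuous_ofReal.comp hsc)).locallyIntegrable
  have hz := ae_eq_zero_of_integral_contDiff_smul_eq_zero hloc fun φ hφ hs => by
    have hc := hφ.continuous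
    set I := ∫ x, sech (x / √2) * φ x with hI
    have h1 := key (fun x => φ x - I / J * χ x) (hc.sub (χ.continuous.const_mul _))
      (hs.sub χ.hasCompactSupport.mul_left) (by
        have e : (fun x => sech (x / √2) * (φ x - I / J * χ x)) =
            fun x => sech (x / √2) * φ x - I / J * (sech (x / √2) * χ x) := by
          ext x; ring
        rw [e, integral_sub (hint φ hc hs) ((hint χ χ.continuous χ.hasCompactSupport).const_mul _),
          integral_const_mul, ← hI, ← hJ, div_mul_cancel₀ _ hJpos.ne', sub_self])
    have e1 : (fun x => ((φ x - I / J * χ x : ℝ) : ℂ) * u x) =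
        fun x => (φ x : ℂ) * u x - ((I / J : ℝ) : ℂ) * ((χ x : ℂ) * u x) := by
      ext x; push_cast; ring
    rw [e1, integral_sub (hintu φ hc hs)
      ((hintu χ χ.continuous χ.hasCompactSupport).const_mul _), integral_const_mul] at h1
    have e2 : (fun x => φ x • (u x - c * (sech (x / √2) : ℂ))) =
        fun x => (φ x : ℂ) * u x - c * ((sech (x / √2) * φ x : ℝ) : ℂ) := by
      ext x; rw [Complex.real_smul]; push_cast; ring
    have hi : Integrable (fun x => ((sech (x / √2) * φ x : ℝ) : ℂ)) := (hint φ hc hs).ofReal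
    rw [e2, integral_sub (hintu φ hc hs) (hi.const_mul _),
      integral_const_mul, integral_complex_ofReal, ← hI, ← h1, hcdef]
    push_cast
    ring
  filter_upwards [hz] with x hx
  exact sub_eq_zero.1 hx

end GroundState

/-! ### Classical solutions and resonances -/

section Calculus

theorem hasDerivAt_slice_fst {F : ℝ × ℝ → ℝ} {t x : ℝ} (hF : DifferentiableAt ℝ F (t, x)) :
    HasDerivAt (fun s => F (s, x)) (fderiv ℝ F (t, x) (1, 0)) t :=
  hF.hasFDerivAt.comp_hasDerivAt t ((hasDerivAt_id t).prodMk (hasDerivAt_const t x))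

theorem hasDerivAt_slice_snd {F : ℝ × ℝ → ℝ} {t x : ℝ} (hF : DifferentiableAt ℝ F (t, x)) :
    HasDerivAt (fun y => F (t, y)) (fderiv ℝ F (t, x) (0, 1)) x :=
  hF.hasFDerivAt.comp_hasDerivAt x ((hasDerivAt_const x t).prodMk (hasDerivAt_id x))

theorem differentiable_fderiv_apply {F : ℝ × ℝ → ℝ} (hF : ContDiff ℝ 2 F) (v : ℝ × ℝ) :
    Differentiable ℝ fun p => fderiv ℝ F p v :=
  ((hF.fderiv_right (m := 1) (by norm_num)).differentiable one_ne_zero).clm_apply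
    (differentiable_const v)

theorem fderiv_fderiv_apply_comm {F : ℝ × ℝ → ℝ} (hF : ContDiff ℝ 2 F) (p v w : ℝ × ℝ) :
    fderiv ℝ (fun q => fderiv ℝ F q v) p w = fderiv ℝ (fun q => fderiv ℝ F q w) p v := by
  have hd : DifferentiableAt ℝ (fderiv ℝ F) p :=
    (hF.fderiv_right (m := 1) (by norm_num)).differentiable one_ne_zero p
  have h := hF.contDiffAt.isSymmSndFDerivAt (x := p) (by simp)
  rw [fderiv_clm_apply hd (differentiableAt_const v),
    fderiv_clm_apply hd (differentiableAt_const w)]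
  simpa using h w v

/-- Both wave equations follow on differentiating the two equations of the system in `t` and in `x`
and eliminating the mixed derivatives, which are symmetric as `φ` and `ψ` are `C²`. -/
theorem SolvesLBT.solvesWave {φ ψ : ℝ → ℝ → ℝ} (h : SolvesLBT φ ψ) :
    SolvesWave potH φ ∧ SolvesWave potTilde ψ := by
  set F : ℝ × ℝ → ℝ := fun p => φ p.1 p.2
  set G : ℝ × ℝ → ℝ := fun p => ψ p.1 p.2
  have hF : ContDiff ℝ 2 F := h.contDiff_fst
  have hG : ContDiff ℝ 2 G := h.contDiff_snd
  have dF := hF.differentiable two_ne_zero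
  have dG := hG.differentiable two_ne_zero
  have Ft : ∀ t x, HasDerivAt (fun s => φ s x) (fderiv ℝ F (t, x) (1, 0)) t :=
    fun t x => hasDerivAt_slice_fst (dF (t, x))
  have Fx : ∀ t x, HasDerivAt (φ t) (fderiv ℝ F (t, x) (0, 1)) x :=
    fun t x => hasDerivAt_slice_snd (dF (t, x))
  have Gt : ∀ t x, HasDerivAt (fun s => ψ s x) (fderiv ℝ G (t, x) (1, 0)) t :=
    fun t x => hasDerivAt_slice_fst (dG (t, x))
  have Gx : ∀ t x, HasDerivAt (ψ t) (fderiv ℝ G (t, x) (0, 1)) x :=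
    fun t x => hasDerivAt_slice_snd (dG (t, x))
  have e1 : ∀ t x, fderiv ℝ F (t, x) (0, 1) - fderiv ℝ G (t, x) (1, 0) = -√2 * kink x * φ t x :=
    fun t x => by rw [← (Fx t x).deriv, ← (Gt t x).deriv]; exact h.eq_fst t x
  have e2 : ∀ t x, fderiv ℝ F (t, x) (1, 0) - fderiv ℝ G (t, x) (0, 1) = -√2 * kink x * ψ t x :=
    fun t x => by rw [← (Ft t x).deriv, ← (Gx t x).deriv]; exact h.eq_snd t x
  -- the two equations, each differentiated in `t` and in `x`
  have d1x : ∀ t x, fderiv ℝ (fun q => fderiv ℝ F q (0, 1)) (t, x) (0, 1) -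
      fderiv ℝ (fun q => fderiv ℝ G q (1, 0)) (t, x) (0, 1) =
        -√2 * ((1 - kink x ^ 2) / √2) * φ t x +
          -√2 * kink x * fderiv ℝ F (t, x) (0, 1) := fun t x => by
    have h1 := (hasDerivAt_slice_snd (differentiable_fderiv_apply hF (0, 1) (t, x))).sub
      (hasDerivAt_slice_snd (differentiable_fderiv_apply hG (1, 0) (t, x)))
    have h2 := ((hasDerivAt_kink x).const_mul (-√2)).mul (Fx t x)
    refine h1.unique (h2.congr_of_eventuallyEq (.of_forall fun y => e1 t y))
  have d1t : ∀ t x, fderiv ℝ (fun q => fderiv ℝ F q (0, 1)) (t, x) (1, 0) -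
      fderiv ℝ (fun q => fderiv ℝ G q (1, 0)) (t, x) (1, 0) =
        -√2 * kink x * fderiv ℝ F (t, x) (1, 0) := fun t x => by
    have h1 := (hasDerivAt_slice_fst (differentiable_fderiv_apply hF (0, 1) (t, x))).sub
      (hasDerivAt_slice_fst (differentiable_fderiv_apply hG (1, 0) (t, x)))
    have h2 := (Ft t x).const_mul (-√2 * kink x)
    refine h1.unique (h2.congr_of_eventuallyEq (.of_forall fun y => e1 y x))
  have d2x : ∀ t x, fderiv ℝ (fun q => fderiv ℝ F q (1, 0)) (t, x) (0, 1) -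
      fderiv ℝ (fun q => fderiv ℝ G q (0, 1)) (t, x) (0, 1) =
        -√2 * ((1 - kink x ^ 2) / √2) * ψ t x +
          -√2 * kink x * fderiv ℝ G (t, x) (0, 1) := fun t x => by
    have h1 := (hasDerivAt_slice_snd (differentiable_fderiv_apply hF (1, 0) (t, x))).sub
      (hasDerivAt_slice_snd (differentiable_fderiv_apply hG (0, 1) (t, x)))
    have h2 := ((hasDerivAt_kink x).const_mul (-√2)).mul (Gx t x)
    refine h1.unique (h2.congr_of_eventuallyEq (.of_forall fun y => e2 t y))
  have d2t : ∀ t x, fderiv ℝ (fun q => fderiv ℝ F q (1, 0)) (t, x) (1, 0) -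
      fderiv ℝ (fun q => fderiv ℝ G q (0, 1)) (t, x) (1, 0) =
        -√2 * kink x * fderiv ℝ G (t, x) (1, 0) := fun t x => by
    have h1 := (hasDerivAt_slice_fst (differentiable_fderiv_apply hF (1, 0) (t, x))).sub
      (hasDerivAt_slice_fst (differentiable_fderiv_apply hG (0, 1) (t, x)))
    have h2 := (Gt t x).const_mul (-√2 * kink x)
    refine h1.unique (h2.congr_of_eventuallyEq (.of_forall fun y => e2 y x))
  have second : ∀ (θ : ℝ → ℝ → ℝ) (K : ℝ × ℝ → ℝ), ContDiff ℝ 2 K →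
      (∀ t x, HasDerivAt (fun s => θ s x) (fderiv ℝ K (t, x) (1, 0)) t) →
      (∀ t x, HasDerivAt (θ t) (fderiv ℝ K (t, x) (0, 1)) x) → ∀ t x,
      deriv (deriv fun s => θ s x) t = fderiv ℝ (fun q => fderiv ℝ K q (1, 0)) (t, x) (1, 0) ∧
      deriv (deriv (θ t)) x = fderiv ℝ (fun q => fderiv ℝ K q (0, 1)) (t, x) (0, 1) := by
    intro θ K hK h1 h2 t x
    have a : (deriv fun s => θ s x) = fun s => fderiv ℝ K (s, x) (1, 0) :=
      funext fun s => (h1 s x).deriv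
    have b : deriv (θ t) = fun y => fderiv ℝ K (t, y) (0, 1) := funext fun y => (h2 t y).deriv
    rw [a, b]
    exact ⟨(hasDerivAt_slice_fst (differentiable_fderiv_apply hK (1, 0) (t, x))).deriv,
      (hasDerivAt_slice_snd (differentiable_fderiv_apply hK (0, 1) (t, x))).deriv⟩
  have hs : √(2 : ℝ) ≠ 0 := by positivity
  have hk : ∀ x, -√2 * ((1 - kink x ^ 2) / √2) = -(1 - kink x ^ 2) := fun x => by field_simp
  constructor
  · intro t x
    obtain ⟨h1, h2⟩ := second φ F hF Ft Fx t x
    rw [schrodingerExpr, h1, h2, potH]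
    have c := fderiv_fderiv_apply_comm hG (t, x) (1, 0) (0, 1)
    have a := d1x t x
    rw [hk] at a
    linear_combination d2t t x - a - c + √2 * kink x * e1 t x - kink x ^ 2 * φ t x * sqrt_two_sq
  · intro t x
    obtain ⟨h1, h2⟩ := second ψ G hG Gt Gx t x
    rw [schrodingerExpr, h1, h2, potTilde]
    have c := fderiv_fderiv_apply_comm hF (t, x) (1, 0) (0, 1)
    have a := d2x t x
    rw [hk] at a
    linear_combination a - d1t t x - c + √2 * kink x * e2 t x - kink x ^ 2 * ψ t x * sqrt_two_sq

theorem contDiff_kink : ContDiff ℝ 2 kink := by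
  have e : kink = fun y => Real.sinh (y / √2) / Real.cosh (y / √2) := by
    funext y; exact Real.tanh_eq_sinh_div_cosh _
  rw [e]
  exact (Real.contDiff_sinh.comp (contDiff_id.div_const _)).div
    (Real.contDiff_cosh.comp (contDiff_id.div_const _)) fun x => (Real.cosh_pos _).ne'

theorem contDiff_sech : ContDiff ℝ 2 fun x : ℝ => sech (x / √2) :=
  contDiff_const.div (Real.contDiff_cosh.comp (contDiff_id.div_const _))
    fun x => (Real.cosh_pos _).ne'

/-- For `φ = f(x) α(t)` and `ψ = g(x) β(t)` the system can be checked on one-variable derivatives.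
-/
theorem solvesLBT_of_separated {f f' g g' α α' β β' : ℝ → ℝ} (hf : ContDiff ℝ 2 f)
    (hg : ContDiff ℝ 2 g) (ha : ContDiff ℝ 2 α) (hb : ContDiff ℝ 2 β)
    (df : ∀ x, HasDerivAt f (f' x) x) (dg : ∀ x, HasDerivAt g (g' x) x)
    (da : ∀ t, HasDerivAt α (α' t) t) (db : ∀ t, HasDerivAt β (β' t) t)
    (h1 : ∀ t x, f' x * α t - g x * β' t = -√2 * kink x * (f x * α t))
    (h2 : ∀ t x, f x * α' t - g' x * β t = -√2 * kink x * (g x * β t)) :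
    SolvesLBT (fun t x => f x * α t) (fun t x => g x * β t) where
  contDiff_fst := (hf.comp contDiff_snd).mul (ha.comp contDiff_fst)
  contDiff_snd := (hg.comp contDiff_snd).mul (hb.comp contDiff_fst)
  eq_fst t x := by
    rw [((df x).mul_const (α t)).deriv, ((db t).const_mul (g x)).deriv]
    exact h1 t x
  eq_snd t x := by
    rw [((da t).const_mul (f x)).deriv, ((dg x).mul_const (β t)).deriv]
    exact h2 t x

theorem deriv_kink : deriv kink = fun x => (1 - kink x ^ 2) / √2 :=
  funext fun x => (hasDerivAt_kink x).deriv

theorem hasDerivAt_deriv_kink (x : ℝ) :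
    HasDerivAt (deriv kink) (-kink x * (1 - kink x ^ 2)) x := by
  rw [deriv_kink]
  have h := (((hasDerivAt_kink x).pow 2).const_sub 1).div_const √2
  convert! h using 1
  have h2 := sqrt_two_sq
  have hs : √(2 : ℝ) ≠ 0 := by positivity
  field_simp
  rw [sq √2, h2]
  push_cast
  ring

theorem solvesLBT_deriv_kink : SolvesLBT (fun _ x => deriv kink x) (fun _ _ => 0) := by
  have hc : ContDiff ℝ 2 (deriv kink) := by
    rw [deriv_kink]
    exact (contDiff_const.sub (contDiff_kink.pow 2)).div_const _
  have h := solvesLBT_of_separated hc (contDiff_const (c := (0 : ℝ)))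
    (contDiff_const (c := (1 : ℝ))) (contDiff_const (c := (1 : ℝ))) hasDerivAt_deriv_kink
    (fun x => hasDerivAt_const x _)
    (fun t => hasDerivAt_const t _) (fun t => hasDerivAt_const t _) (fun t x => ?_) (fun t x => ?_)
  · simpa using h
  · rw [deriv_kink]
    have hs : √(2 : ℝ) ≠ 0 := by positivity
    field_simp
    ring
  · ring

theorem hasDerivAt_sin_mul (ω t : ℝ) :
    HasDerivAt (fun s => Real.sin (ω * s)) (ω * Real.cos (ω * t)) t := by
  convert! ((hasDerivAt_id t).const_mul ω).sin using 1
  simp [mul_comm]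

theorem hasDerivAt_cos_mul (ω t : ℝ) :
    HasDerivAt (fun s => Real.cos (ω * s)) (-(ω * Real.sin (ω * t))) t := by
  convert! ((hasDerivAt_id t).const_mul ω).cos using 1
  simp [mul_comm]

theorem solvesLBT_internal_mode : SolvesLBT (fun t x => Y₁ x * Real.sin (t * √(3 / 2)))
    (fun t x => Y₀ x * Real.cos (t * √(3 / 2))) := by
  simp only [mul_comm _ √(3 / 2)]
  have hY₁ : ∀ x, HasDerivAt Y₁ (sech (x / √2) * (1 - 2 * kink x ^ 2) / √2) x := fun x => by
    convert! (hasDerivAt_sech x).mul (hasDerivAt_kink x) using 1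
    ring
  have hs : √(3 / 2 : ℝ) = √3 / √2 := Real.sqrt_div (by norm_num) 2
  have h2 : √(2 : ℝ) ≠ 0 := by positivity
  have h3 : √(3 : ℝ) ≠ 0 := by positivity
  have h2' := sqrt_two_sq
  have h3' : √(3 : ℝ) * √3 = 3 := Real.mul_self_sqrt (by norm_num)
  refine solvesLBT_of_separated (contDiff_sech.mul contDiff_kink) (contDiff_const.mul contDiff_sech)
    (Real.contDiff_sin.comp (contDiff_const.mul contDiff_id))
    (Real.contDiff_cos.comp (contDiff_const.mul contDiff_id)) hY₁
    (fun x => (hasDerivAt_sech x).const_mul _) (hasDerivAt_sin_mul _) (hasDerivAt_cos_mul _)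
    (fun t x => ?_) (fun t x => ?_)
  · have e : Y₁ x = sech (x / √2) * kink x := rfl
    rw [e, Y₀, hs]
    field_simp
    linear_combination (sech (x / √2) * Real.sin (√3 * t / √2) * kink x ^ 2) * h2'
  · have e : Y₁ x = sech (x / √2) * kink x := rfl
    rw [e, Y₀, hs]
    field_simp
    linear_combination (sech (x / √2) * Real.cos (√3 * t / √2) * kink x) * (h3' - h2')

theorem hasDerivAt_resProfile (x : ℝ) :
    HasDerivAt resProfile (3 * sech (x / √2) ^ 2 * kink x / √2) x := by
  convert! (((hasDerivAt_sech x).pow 2).const_mul (3 / 2)).const_sub 1 using 1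
  push_cast
  ring

theorem contDiff_resProfile : ContDiff ℝ 2 resProfile :=
  contDiff_const.sub (contDiff_const.mul (contDiff_sech.pow 2))

theorem solvesLBT_resonance : SolvesLBT L₄ M₄ := by
  have h2 : √(2 : ℝ) ≠ 0 := by positivity
  have h2' := sqrt_two_sq
  refine solvesLBT_of_separated contDiff_resProfile.neg contDiff_kink
    (Real.contDiff_sin.comp (contDiff_const.mul contDiff_id))
    (Real.contDiff_cos.comp (contDiff_const.mul contDiff_id))
    (fun x => (hasDerivAt_resProfile x).neg) hasDerivAt_kink
    (hasDerivAt_sin_mul _) (hasDerivAt_cos_mul _) (fun t x => ?_) (fun t x => ?_)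
  · change -(3 * sech (x / √2) ^ 2 * kink x / √2) * Real.sin (√2 * t) -
      kink x * -(√2 * Real.sin (√2 * t)) =
        -√2 * kink x * (-(1 - 3 / 2 * sech (x / √2) ^ 2) * Real.sin (√2 * t))
    rw [sech_sq]
    field_simp
    rw [sq √2, h2']
    ring
  · change -(1 - 3 / 2 * sech (x / √2) ^ 2) * (√2 * Real.cos (√2 * t)) -
      (1 - kink x ^ 2) / √2 * Real.cos (√2 * t) =
        -√2 * kink x * (kink x * Real.cos (√2 * t))
    rw [sech_sq]
    field_simp
    rw [sq √2, h2']
    ring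

/-- The bound makes `|H|` and `1 - (3/2) sech²` at least `1/2` on `[4, ∞)`. -/
theorem sech_sq_le {x : ℝ} (hx : 4 ≤ x) : sech (x / √2) ^ 2 ≤ 1 / 9 := by
  rw [sech, div_pow, one_pow]
  refine one_div_le_one_div_of_le (by norm_num) ?_
  have := one_add_sq_le_cosh_sq (x / √2)
  rw [div_pow, Real.sq_sqrt zero_le_two] at this
  nlinarith

/-- A function that is at least `1/2` in absolute value on `[4, ∞)` is not square integrable. -/
theorem not_memLp_two {f : ℝ → ℝ} (hf : ∀ x, 4 ≤ x → 1 / 2 ≤ |f x|) : ¬ MemLp f 2 volume := by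
  intro h
  have h1 := h.meas_ge_lt_top (ε := 1 / 2) two_ne_zero ENNReal.ofNat_ne_top (by norm_num)
  refine (h1.trans_le' (measure_mono (s := Set.Ici (4 : ℝ)) fun x hx => ?_)).ne Real.volume_Ici
  rw [Set.mem_ofPred_eq, ← NNReal.coe_le_coe]
  simpa using hf x hx

theorem isResonance_kink : IsResonance potTilde 2 kink where
  contDiff := contDiff_kink
  eigen_eq x := by
    rw [schrodingerExpr, (hasDerivAt_deriv_kink x).deriv, potTilde]
    ring
  mem_top := memLp_top_of_bound continuous_kink.aestronglyMeasurable 1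
    (.of_forall fun x => abs_kink_le x)
  notMem_two := not_memLp_two fun x hx => by
    have h1 := sech_sq_le hx
    rw [sech_sq, ← sq_abs] at h1
    nlinarith [abs_nonneg (kink x)]

theorem isResonance_resProfile : IsResonance potH 2 resProfile where
  contDiff := contDiff_resProfile
  eigen_eq x := by
    have e : deriv resProfile = fun x => 3 * sech (x / √2) ^ 2 * kink x / √2 :=
      funext fun x => (hasDerivAt_resProfile x).deriv
    have h : HasDerivAt (fun x => 3 * sech (x / √2) ^ 2 * kink x / √2) _ x :=
      ((((hasDerivAt_sech x).pow 2).const_mul 3).mul (hasDerivAt_kink x)).div_const √2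
    rw [schrodingerExpr, e, h.deriv, resProfile, potH]
    have hs : √(2 : ℝ) ≠ 0 := by positivity
    have h2 := sqrt_two_sq
    have h1 := sech_sq x
    simp only [Pi.pow_apply, Nat.add_one_sub_one, pow_one, Nat.cast_ofNat]
    field_simp
    rw [sq √2, h2, h1]
    ring
  mem_top := by
    refine memLp_top_of_bound contDiff_resProfile.continuous.aestronglyMeasurable 3
      (.of_forall fun x => ?_)
    have := abs_kink_le x
    rw [← sq_le_one_iff_abs_le_one] at this
    rw [Real.norm_eq_abs, resProfile, sech_sq, abs_le]
    constructor <;> nlinarith [sq_nonneg (kink x)]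
  notMem_two := not_memLp_two fun x hx => by
    have h1 := sech_sq_le hx
    refine le_trans ?_ (le_abs_self _)
    rw [resProfile]
    linarith

theorem odd_kink : Function.Odd kink := fun x => by
  rw [kink, kink, neg_div, Real.tanh_neg]

theorem even_resProfile : Function.Even resProfile := fun x => by
  rw [resProfile, resProfile, sech, sech, neg_div, Real.cosh_neg]

/-- The wave equations do not couple `φ` and `ψ`: the pair of `0` and the second component of the
internal mode satisfies them, but the first equation of the system fails for it at `x = 0`. -/
theorem exists_solvesWave_not_solvesLBT : ∃ φ ψ : ℝ → ℝ → ℝ,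
      ContDiff ℝ 2 (fun p : ℝ × ℝ => φ p.1 p.2) ∧ ContDiff ℝ 2 (fun p : ℝ × ℝ => ψ p.1 p.2) ∧
      SolvesWave potH φ ∧ SolvesWave potTilde ψ ∧ ¬ SolvesLBT φ ψ := by
  refine ⟨fun _ _ => 0, fun t x => Y₀ x * Real.cos (t * √(3 / 2)), contDiff_const,
    solvesLBT_internal_mode.contDiff_snd, fun t x => by simp [schrodingerExpr],
    solvesLBT_internal_mode.solvesWave.2, fun h => ?_⟩
  have h1 := h.eq_fst (Real.pi / 2 / √(3 / 2)) 0
  have hw : √(3 / 2 : ℝ) ≠ 0 := by positivity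
  have h3 : √(3 : ℝ) ≠ 0 := by positivity
  simp only [mul_comm _ √(3 / 2)] at h1
  rw [((hasDerivAt_cos_mul _ _).const_mul _).deriv, mul_div_cancel₀ _ hw] at h1
  simp [Y₀, sech] at h1

end Calculus

/-! ### Spectrum and eigenvalues of `L̃_H` -/

section Spectrum

/-- Elements of the domain as `(1 - ∂²)⁻¹ f`, and `L̃_H - z` in terms of the pencil. -/
theorem exists_of_mem_domain (u : opTilde.domain) (z : ℂ) :
    ∃ f : L2R, secondOrderResolvent f = u ∧ kinkPencil z f = opTilde u - z • (u : L2R) := by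
  obtain ⟨u, hu⟩ := u
  obtain ⟨f, rfl⟩ := (mem_sobolevH2_iff_exists u).1 hu
  refine ⟨f, rfl, ?_⟩
  rw [opTilde_secondOrderResolvent, kinkPencil_apply, kinkPencil_apply]
  module

theorem not_isUnit_kinkPencil_of_isEigenvalue {z : ℂ} (h : IsEigenvalue opTilde z) :
    ¬ IsUnit (kinkPencil z) := by
  obtain ⟨u, hu, he⟩ := h
  obtain ⟨f, hf, hf'⟩ := exists_of_mem_domain u z
  rintro ⟨U, hU⟩
  rw [he, sub_self, ← hU] at hf'
  have h0 : f = 0 := by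
    have := congrArg (↑U⁻¹ : L2R →L[ℂ] L2R) hf'
    rwa [← mul_apply_eq_comp, Units.inv_mul, map_zero] at this
  rw [h0, map_zero] at hf
  exact hu (Subtype.ext hf.symm)

theorem exists_eigenvector : ∃ y : opTilde.domain,
    ((y : L2R) : ℝ → ℂ) =ᵐ[volume] (fun x => (Y₀ x : ℂ)) ∧ IsEigenvector opTilde (3 / 2) y := by
  obtain ⟨f, hf, hf'⟩ := exists_ground_state (-(1 / √3))
  refine ⟨⟨secondOrderResolvent f, secondOrderResolvent_mem f⟩, hf, fun h => ?_, ?_⟩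
  · have h0 : secondOrderResolvent f = 0 := congrArg Subtype.val h
    rw [h0] at hf
    obtain ⟨x, hx, hx'⟩ := (hf.and (Lp.coeFn_zero ℂ 2 volume)).exists
    rw [hx', Pi.zero_apply, eq_comm, Complex.ofReal_eq_zero] at hx
    have := (sech_pos (x / √2)).ne'
    have h3 : √(3 : ℝ) ≠ 0 := by positivity
    simp [this, h3] at hx
  · refine (opTilde_secondOrderResolvent f _).trans ?_
    change kinkPencil 0 f = (3 / 2 : ℂ) • secondOrderResolvent f
    rw [← sub_eq_zero, ← hf', kinkPencil_apply, kinkPencil_apply]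
    module

/-- The constant in the conclusion is `-√3 c`, where `u = c sech (x / √2)` and
`y = -(1/√3) sech (x / √2)`. -/
theorem exists_eq_smul_of_eigenvector {y : opTilde.domain}
    (hy : ((y : L2R) : ℝ → ℂ) =ᵐ[volume] (fun x => (Y₀ x : ℂ))) {u : opTilde.domain}
    (hu : opTilde u = (3 / 2 : ℂ) • (u : L2R)) : ∃ c : ℂ, u = c • y := by
  obtain ⟨f, hf, hf'⟩ := exists_of_mem_domain u (3 / 2)
  rw [hu, sub_self] at hf'
  have h := isDarbouxTriple_kink.star_factor_apply_eq_zero hf'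
  rw [← secondOrderResolvent, hf] at h
  obtain ⟨c, hc⟩ := ae_eq_sech_of_star_factor_eq_zero h
  refine ⟨c * (-√3 : ℝ), Subtype.ext (Lp.ext ?_)⟩
  filter_upwards [hc, hy, Lp.coeFn_smul (c * (-√3 : ℝ)) (y : L2R)] with x h1 h2 h3
  refine h1.trans (Eq.trans ?_ h3.symm)
  rw [Pi.smul_apply, h2, smul_eq_mul, mul_assoc, ← Complex.ofReal_mul, Y₀]
  congr 2
  have : √(3 : ℝ) ≠ 0 := by positivity
  field_simp

/-- The free partner `-∂² + 2` contributes `[2, ∞)`, and the kernel of `∂ + a` contributes `3/2`. -/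
theorem unbddSpectrum_opTilde :
    unbddSpectrum opTilde = (fun r : ℝ => (r : ℂ)) '' ({3 / 2} ∪ Set.Ici 2) := by
  ext z
  rw [unbddSpectrum, Set.mem_compl_iff, mem_resolventSet_opTilde_iff]
  constructor
  · intro h
    by_contra hz
    refine h (isDarbouxTriple_kink.isUnit_pencil (fun e => hz ?_) fun r hr e => hz ?_)
    · exact ⟨3 / 2, Or.inl rfl, by rw [e]; push_cast; rfl⟩
    · refine ⟨r + 1, Or.inr ?_, ?_⟩
      · rw [Set.mem_Ici]
        linarith
      · change ((r + 1 : ℝ) : ℂ) = z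
        rw [Complex.ofReal_add, ← e]
        simp
  · rintro ⟨r, hr | hr, rfl⟩
    · rw [Set.mem_singleton_iff] at hr
      obtain ⟨y, -, hy⟩ := exists_eigenvector
      refine not_isUnit_kinkPencil_of_isEigenvalue ⟨y, ?_⟩
      convert! hy
      rw [hr]
      push_cast
      rfl
    · rw [Set.mem_Ici] at hr
      intro h
      refine not_isUnit_one_sub_smul (r := r - 1) (by linarith) ?_
      have := isDarbouxTriple_kink.isUnit_of_isUnit_pencil h
      rwa [Complex.ofReal_sub, Complex.ofReal_one]

theorem mem_of_isEigenvalue {r : ℝ} (h : IsEigenvalue opTilde (r : ℂ)) : r = 3 / 2 ∨ 2 ≤ r := by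
  have hs : (r : ℂ) ∈ unbddSpectrum opTilde := by
    rw [unbddSpectrum, Set.mem_compl_iff, mem_resolventSet_opTilde_iff]
    exact not_isUnit_kinkPencil_of_isEigenvalue h
  rw [unbddSpectrum_opTilde] at hs
  obtain ⟨s, hs, e⟩ := hs
  rw [← Complex.ofReal_injective e]
  exact hs

end Spectrum

end

theorem lemma5p2 :
    -- solutions of the LBT solve the two wave equations; the converse fails; `L̃_H ≥ 0`
    (∀ φ ψ : ℝ → ℝ → ℝ, SolvesLBT φ ψ → SolvesWave potH φ ∧ SolvesWave potTilde ψ) ∧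
    (∃ φ ψ : ℝ → ℝ → ℝ,
      ContDiff ℝ 2 (fun p : ℝ × ℝ => φ p.1 p.2) ∧ ContDiff ℝ 2 (fun p : ℝ × ℝ => ψ p.1 p.2) ∧
      SolvesWave potH φ ∧ SolvesWave potTilde ψ ∧ ¬ SolvesLBT φ ψ) ∧
    (∀ u : opTilde.domain, 0 ≤ (inner ℂ (u : L2R) (opTilde u)).re ∧
      (inner ℂ (u : L2R) (opTilde u)).im = 0) ∧
    -- `(H', 0)` solves the LBT
    SolvesLBT (fun _ x => deriv kink x) (fun _ _ => 0) ∧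
    -- the spectrum, the first eigenvalue with its eigenfunction, and the odd resonance of `L̃_H`
    unbddSpectrum opTilde = (fun r : ℝ => (r : ℂ)) '' ({3 / 2} ∪ Set.Ici 2) ∧
    ¬ IsEigenvalue opTilde 0 ∧
    IsLeast {r : ℝ | IsEigenvalue opTilde (r : ℂ)} (3 / 2) ∧
    (∃ y : opTilde.domain, ((y : L2R) : ℝ → ℂ) =ᵐ[volume] (fun x => (Y₀ x : ℂ)) ∧
      IsEigenvector opTilde (3 / 2) y ∧
      ∀ u : opTilde.domain, opTilde u = (3 / 2 : ℂ) • (u : L2R) → ∃ c : ℂ, u = c • y) ∧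
    (IsResonance potTilde 2 kink ∧ Function.Odd kink) ∧
    -- the internal-mode pair
    SolvesLBT (fun t x => Y₁ x * Real.sin (t * √(3 / 2)))
      (fun t x => Y₀ x * Real.cos (t * √(3 / 2))) ∧
    -- the resonance pair; the profile of `L₄` is an even resonance of `L_H`
    (IsResonance potH 2 resProfile ∧ Function.Even resProfile) ∧
    SolvesLBT L₄ M₄ := by
  obtain ⟨y, hy, hy'⟩ := exists_eigenvector
  refine ⟨fun φ ψ h => h.solvesWave, exists_solvesWave_not_solvesLBT, fun u => ?_,
    solvesLBT_deriv_kink, unbddSpectrum_opTilde, fun h => ?_, ⟨⟨y, ?_⟩, fun r hr => ?_⟩,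
    ⟨y, hy, hy', fun u hu => exists_eq_smul_of_eigenvector hy hu⟩,
    ⟨isResonance_kink, odd_kink⟩, solvesLBT_internal_mode,
    ⟨isResonance_resProfile, even_resProfile⟩, solvesLBT_resonance⟩
  · obtain ⟨r, hr, h⟩ := inner_opTilde u
    rw [h]
    exact ⟨hr, rfl⟩
  · rw [← Complex.ofReal_zero] at h
    rcases mem_of_isEigenvalue h with h | h <;> norm_num at h
  · convert! hy'
    push_cast
    rfl
  · rcases mem_of_isEigenvalue hr with h | h <;> linarith
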